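/- Let $n\ge 2$ and let $F_n$ be the free group of rank $n$, identified with the fundamental group of the rose $R_n$ with $n$ petals. A marked metric graph $A$ of rank $n$ is a finite connected graph, all of whose vertices have valence at least three, with a positive length assigned to every edge, together with a homotopy equivalence $\tau_A\colon R_n\to A$. Two marked metric graphs $A,B$ are equivalent if there is a homothety $h\colon A\to B$ such that $h\circ\tau_A$ is freely homotopic to $\tau_B$. Culler–Vogtmann space $CV_n$ is the set of equivalence classes. For $w\in F_n$ let $l_A(w)$ be the translation length of $w$ on the universal cover of $A$, that is, the length of a shortest loop in the free homotopy class of loops in $A$ defined by $w$ through $\tau_A$. The usual topology on $CV_n$ is the one induced by the map $$CV_n\to \mathbb{R}^{F_n}/\!\sim,\qquad A\mapsto [\,l_A\,],$$ where $f\sim g$ if and only if $g=cf$ for some $c>0$, and $\mathbb{R}^{F_n}/\!\sim$ has the quotient of the product topology. Put $$\Lambda_R(A,B)=\sup_{1\neq w\in F_n}\frac{l_B(w)}{l_A(w)},\qquad \Lambda_L(A,B)=\sup_{1\neq w\in F_n}\frac{l_A(w)}{l_B(w)},\qquad d(A,B)=\log\bigl(\Lambda_R(A,B)\,\Lambda_L(A,B)\bigr),$$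 which depends only on the classes of $A$ and $B$ in $CV_n$. Theorem. The topology on $CV_n$ induced by the symmetric metric $d$ (a set is open if and only if it contains, with each of its points, a $d$-ball of positive radius about that point) coincides with the usual topology of $CV_n$. -/

import Mathlib

open scoped ENNReal

/-- A finite connected metric graph (loops and multiple edges allowed), all of whose vertices have
valence at least three, with a positive length on every edge.  Every edge `e` carries an arbitrary
reference orientation from `src e` to `tgt e`. -/
structure MetricGraph where
  V : Type
  E : Type
  finite_V : Finite V
  finite_E : Finite E
  src : E → V
  tgt : E → V
  len : E → ℝ
  len_pos : ∀ e, 0 < len e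
  /-- Each vertex is the origin of at least three oriented edges (a loop counts twice). -/
  three_le_valence : ∀ v : V,
    3 ≤ Nat.card {a : E × Bool // (if a.2 then src a.1 else tgt a.1) = v}
  /-- Any two vertices are joined by a finite chain of edges. -/
  connected : ∀ u v : V,
    Relation.ReflTransGen (fun x y => ∃ e, (src e = x ∧ tgt e = y) ∨ (src e = y ∧ tgt e = x)) u v

namespace MetricGraph

/-- Oriented edges: `(e, true)` is `e` with its reference orientation, `(e, false)` is `e` with the
opposite orientation. -/
abbrev Dart (A : MetricGraph) : Type := A.E × Bool

/-- Origin of an oriented edge. -/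
def dartSrc (A : MetricGraph) (a : A.Dart) : A.V := if a.2 then A.src a.1 else A.tgt a.1

/-- Terminal vertex of an oriented edge. -/
def dartTgt (A : MetricGraph) (a : A.Dart) : A.V := if a.2 then A.tgt a.1 else A.src a.1

/-- The same edge with the opposite orientation. -/
def dartRev (A : MetricGraph) (a : A.Dart) : A.Dart := (a.1, !a.2)

/-- `A.IsPath u p v`: the list `p` of oriented edges is an edge path from `u` to `v`. -/
def IsPath (A : MetricGraph) : A.V → List A.Dart → A.V → Prop
  | u, [], v => u = v
  | u, a :: p, v => A.dartSrc a = u ∧ A.IsPath (A.dartTgt a) p v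

/-- Length of an edge path. -/
def pathLen (A : MetricGraph) (p : List A.Dart) : ℝ := (p.map fun a => A.len a.1).sum

/-- The homotopy class of an edge path, as an element of the free group on the edges.
Equality in this free group is generated by inserting and deleting backtracks `a, dartRev a`, so two
edge paths with the same endpoints are homotopic relative to their endpoints if and only if their
classes agree; concatenation of paths becomes multiplication. -/
def pathClass (A : MetricGraph) (p : List A.Dart) : FreeGroup A.E := FreeGroup.mk p

lemma IsPath.append {A : MetricGraph} {p q : List A.Dart} {u v w : A.V}
    (hp : A.IsPath u p v) (hq : A.IsPath v q w) : A.IsPath u (p ++ q) w := by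
  induction p generalizing u with
  | nil => cases hp; exact hq
  | cons a p ih => exact ⟨hp.1, ih hp.2⟩

lemma IsPath.rev {A : MetricGraph} {p : List A.Dart} {u v : A.V}
    (hp : A.IsPath u p v) : A.IsPath v (FreeGroup.invRev p) u := by
  induction p generalizing u with
  | nil => cases hp; rfl
  | cons a p ih =>
    have h1 := ih hp.2
    have h2 : A.IsPath (A.dartTgt a) [A.dartRev a] u := by
      refine ⟨?_, ?_⟩
      · rcases a with ⟨e, _ | _⟩ <;> rfl
      · rw [← hp.1]; rcases a with ⟨e, _ | _⟩ <;> rfl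
    have h3 := h1.append h2
    simpa [FreeGroup.invRev, dartRev] using h3

/-- The fundamental group based at the vertex `v`: homotopy classes of closed edge paths at `v`. -/
def pi1 (A : MetricGraph) (v : A.V) : Subgroup (FreeGroup A.E) where
  carrier := {x | ∃ p, A.IsPath v p v ∧ A.pathClass p = x}
  one_mem' := ⟨[], rfl, rfl⟩
  mul_mem' := by
    rintro _ _ ⟨p, hp, rfl⟩ ⟨q, hq, rfl⟩
    exact ⟨p ++ q, hp.append hq, FreeGroup.mul_mk.symm⟩
  inv_mem' := by
    rintro _ ⟨p, hp, rfl⟩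
    exact ⟨FreeGroup.invRev p, hp.rev, FreeGroup.inv_mk.symm⟩

end MetricGraph

/-- A marked metric graph of rank `n`.  The marking, a homotopy equivalence from the rose with `n`
petals to the graph, is recorded by the image `base` of the vertex of the rose and by the
isomorphism that it induces from the fundamental group of the rose, which is the free group on `n`
letters, to the fundamental group of the graph at `base`. -/
structure MarkedGraph (n : ℕ) extends MetricGraph where
  base : V
  marking : FreeGroup (Fin n) ≃* toMetricGraph.pi1 base

/-- A homothety of metric graphs with ratio `ratio`: an isomorphism of graphs multiplying all edge
lengths by `ratio`. (All valences being at least three, a homothety of the underlying metric spaces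
sends vertices to vertices.) -/
structure Homothety (A B : MetricGraph) where
  onV : A.V ≃ B.V
  onDart : A.Dart ≃ B.Dart
  map_src : ∀ a, B.dartSrc (onDart a) = onV (A.dartSrc a)
  map_rev : ∀ a, onDart (A.dartRev a) = B.dartRev (onDart a)
  ratio : ℝ
  ratio_pos : 0 < ratio
  map_len : ∀ a, B.len (onDart a).1 = ratio * A.len a.1

namespace Homothety

variable {A B C : MetricGraph}

/-- The map induced by a homothety on homotopy classes of edge paths. -/
def onClass (h : Homothety A B) : FreeGroup A.E →* FreeGroup B.E :=
  FreeGroup.lift fun e => B.pathClass [h.onDart (e, true)]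

lemma onClass_mk (h : Homothety A B) (p : List A.Dart) :
    h.onClass (A.pathClass p) = B.pathClass (p.map h.onDart) := by
  have key : ∀ a : A.Dart, h.onClass (A.pathClass [a]) = B.pathClass [h.onDart a] := by
    rintro ⟨e, _ | _⟩
    · have h1 : A.pathClass [(e, false)] = (FreeGroup.of e)⁻¹ := rfl
      have h2 := h.map_rev (e, true)
      have h3 : A.dartRev (e, true) = (e, false) := rfl
      rw [h3] at h2
      rw [h1, map_inv, h2]
      simp [onClass, MetricGraph.pathClass, MetricGraph.dartRev, FreeGroup.inv_mk,
        FreeGroup.invRev]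
    · have h1 : A.pathClass [(e, true)] = FreeGroup.of e := rfl
      rw [h1]
      simp [onClass]
  induction p with
  | nil => exact map_one _
  | cons a p ih =>
    have h1 : A.pathClass (a :: p) = A.pathClass [a] * A.pathClass p := rfl
    have h2 : B.pathClass ((a :: p).map h.onDart)
        = B.pathClass [h.onDart a] * B.pathClass (p.map h.onDart) := rfl
    rw [h1, h2, map_mul, ih, key]

lemma map_tgt (h : Homothety A B) (a : A.Dart) :
    B.dartTgt (h.onDart a) = h.onV (A.dartTgt a) := by
  have e1 : ∀ (G : MetricGraph) (a : G.Dart), G.dartSrc (G.dartRev a) = G.dartTgt a := by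
    rintro G ⟨e, _ | _⟩ <;> rfl
  rw [← e1, ← e1, ← h.map_rev, h.map_src]

lemma isPath (h : Homothety A B) {p : List A.Dart} {u v : A.V} (hp : A.IsPath u p v) :
    B.IsPath (h.onV u) (p.map h.onDart) (h.onV v) := by
  induction p generalizing u with
  | nil => cases hp; rfl
  | cons a p ih =>
    refine ⟨by rw [h.map_src, hp.1], ?_⟩
    rw [h.map_tgt]
    exact ih hp.2

lemma pathLen (h : Homothety A B) (p : List A.Dart) :
    B.pathLen (p.map h.onDart) = h.ratio * A.pathLen p := by
  induction p with
  | nil => simp [MetricGraph.pathLen]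
  | cons a p ih =>
    simp only [MetricGraph.pathLen, List.map_cons, List.sum_cons] at ih ⊢
    rw [ih, h.map_len, mul_add]

/-- The identity homothety. -/
def refl (A : MetricGraph) : Homothety A A :=
  ⟨Equiv.refl _, Equiv.refl _, fun _ => rfl, fun _ => rfl, 1, one_pos, by simp⟩

/-- The inverse homothety. -/
noncomputable def symm (h : Homothety A B) : Homothety B A where
  onV := h.onV.symm
  onDart := h.onDart.symm
  map_src a := by
    rw [Equiv.eq_symm_apply, ← h.map_src, Equiv.apply_symm_apply]
  map_rev a := by
    rw [Equiv.symm_apply_eq, h.map_rev, Equiv.apply_symm_apply]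
  ratio := h.ratio⁻¹
  ratio_pos := inv_pos.2 h.ratio_pos
  map_len a := by
    have := h.map_len (h.onDart.symm a)
    rw [Equiv.apply_symm_apply] at this
    rw [this, inv_mul_cancel_left₀ h.ratio_pos.ne']

/-- The composition of two homotheties. -/
noncomputable def trans (h : Homothety A B) (k : Homothety B C) : Homothety A C where
  onV := h.onV.trans k.onV
  onDart := h.onDart.trans k.onDart
  map_src a := by simp [k.map_src, h.map_src]
  map_rev a := by simp [k.map_rev, h.map_rev]
  ratio := k.ratio * h.ratio
  ratio_pos := mul_pos k.ratio_pos h.ratio_pos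
  map_len a := by simp [k.map_len, h.map_len, mul_assoc]

lemma exists_mk (A : MetricGraph) (x : FreeGroup A.E) : ∃ p, A.pathClass p = x :=
  Quot.exists_rep x

lemma symm_onClass (h : Homothety A B) (x : FreeGroup A.E) :
    h.symm.onClass (h.onClass x) = x := by
  obtain ⟨p, rfl⟩ := exists_mk A x
  rw [onClass_mk, onClass_mk, List.map_map]
  congr 1
  convert List.map_id p
  funext a
  exact h.onDart.symm_apply_apply a

lemma trans_onClass (h : Homothety A B) (k : Homothety B C) (x : FreeGroup A.E) :
    (h.trans k).onClass x = k.onClass (h.onClass x) := by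
  obtain ⟨p, rfl⟩ := exists_mk A x
  rw [onClass_mk, onClass_mk, onClass_mk, List.map_map]
  rfl

end Homothety

namespace MarkedGraph

variable {n : ℕ}

/-- The homothety `h : A → B` commutes with the markings up to free homotopy: there is an edge path
`q` from the base vertex of `B` to the image of the base vertex of `A` (the track of the vertex of
the rose during the homotopy) that conjugates the one marking into the other. -/
def Commutes (A B : MarkedGraph n) (h : Homothety A.toMetricGraph B.toMetricGraph) : Prop :=
  ∃ q, B.IsPath B.base q (h.onV A.base) ∧
    ∀ w, (B.marking w : FreeGroup B.E) =
      B.pathClass q * h.onClass (A.marking w : FreeGroup A.E) * (B.pathClass q)⁻¹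

/-- Equivalence of marked metric graphs: there is a homothety commuting with the markings up to
free homotopy. -/
def Equivalent (A B : MarkedGraph n) : Prop :=
  ∃ h : Homothety A.toMetricGraph B.toMetricGraph, Commutes A B h

lemma Commutes.symm {A B : MarkedGraph n} {h : Homothety A.toMetricGraph B.toMetricGraph}
    (hc : Commutes A B h) : Commutes B A h.symm := by
  obtain ⟨q, hq, hw⟩ := hc
  refine ⟨(FreeGroup.invRev q).map h.symm.onDart, ?_, fun w => ?_⟩
  · have := h.symm.isPath hq.rev
    rwa [show h.symm.onV (h.onV A.base) = A.base from h.onV.symm_apply_apply _] at this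
  · rw [← Homothety.onClass_mk, hw w, map_mul, map_mul, h.symm_onClass,
      show B.pathClass (FreeGroup.invRev q) = (B.pathClass q)⁻¹ from FreeGroup.inv_mk.symm]
    simp [mul_assoc]

lemma Equivalent.refl (A : MarkedGraph n) : Equivalent A A := by
  refine ⟨Homothety.refl _, [], rfl, fun w => ?_⟩
  obtain ⟨p, hp⟩ := Homothety.exists_mk A.toMetricGraph (A.marking w : FreeGroup A.E)
  rw [← hp, Homothety.onClass_mk]
  have : p.map (Homothety.refl A.toMetricGraph).onDart = p := List.map_id p
  rw [this]
  simp [MetricGraph.pathClass, ← FreeGroup.one_eq_mk]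

lemma Equivalent.symm {A B : MarkedGraph n} (h : Equivalent A B) : Equivalent B A :=
  ⟨h.choose.symm, h.choose_spec.symm⟩

lemma Equivalent.trans {A B C : MarkedGraph n} (hAB : Equivalent A B) (hBC : Equivalent B C) :
    Equivalent A C := by
  obtain ⟨h, q, hq, hw⟩ := hAB
  obtain ⟨k, r, hr, hv⟩ := hBC
  refine ⟨h.trans k, r ++ q.map k.onDart, hr.append (k.isPath hq), fun w => ?_⟩
  rw [show C.pathClass (r ++ q.map k.onDart) = C.pathClass r * C.pathClass (q.map k.onDart)
    from FreeGroup.mul_mk.symm, ← Homothety.onClass_mk, Homothety.trans_onClass, hv w, hw w]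
  simp [mul_assoc]

/-- Equivalence of marked metric graphs as a setoid. -/
instance setoid (n : ℕ) : Setoid (MarkedGraph n) :=
  ⟨Equivalent, Equivalent.refl, Equivalent.symm, Equivalent.trans⟩

/-- The closed edge path `p` at `v` represents the free homotopy class of loops defined, through the
marking, by the conjugacy class of `w`. -/
def Represents (A : MarkedGraph n) (v : A.V) (p : List A.Dart) (w : FreeGroup (Fin n)) : Prop :=
  A.IsPath v p v ∧ ∃ q, A.IsPath A.base q v ∧
    A.pathClass q * A.pathClass p * (A.pathClass q)⁻¹ = (A.marking w : FreeGroup A.E)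

/-- The translation length `l_A(w)` of `w` on the universal cover of `A`, that is, the length of a
shortest loop in the free homotopy class of loops in `A` defined by `w`. -/
noncomputable def translationLength (A : MarkedGraph n) (w : FreeGroup (Fin n)) : ℝ :=
  sInf {r | ∃ v p, A.Represents v p w ∧ A.pathLen p = r}

lemma exists_represents (A : MarkedGraph n) (w : FreeGroup (Fin n)) :
    ∃ v p, A.Represents v p w := by
  obtain ⟨p, hp, hw⟩ := (A.marking w).2
  refine ⟨A.base, p, hp, [], rfl, ?_⟩
  rw [hw]
  simp [MetricGraph.pathClass, ← FreeGroup.one_eq_mk]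

lemma pathLen_nonneg (A : MarkedGraph n) (p : List A.Dart) : 0 ≤ A.pathLen p := by
  refine List.sum_nonneg fun x hx => ?_
  obtain ⟨a, -, rfl⟩ := List.mem_map.1 hx
  exact (A.len_pos _).le

lemma Commutes.translationLength_le {A B : MarkedGraph n}
    {h : Homothety A.toMetricGraph B.toMetricGraph} (hc : Commutes A B h)
    (w : FreeGroup (Fin n)) :
    B.translationLength w ≤ h.ratio * A.translationLength w := by
  obtain ⟨q, hq, hw⟩ := hc
  rw [← div_le_iff₀' h.ratio_pos]
  refine le_csInf ?_ ?_
  · obtain ⟨v, p, hp⟩ := A.exists_represents w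
    exact ⟨_, v, p, hp, rfl⟩
  · rintro _ ⟨v, p, ⟨hp, r, hr, hrep⟩, rfl⟩
    rw [div_le_iff₀' h.ratio_pos, ← h.pathLen]
    refine csInf_le ⟨0, ?_⟩ ⟨h.onV v, p.map h.onDart, ⟨h.isPath hp, q ++ r.map h.onDart,
      hq.append (h.isPath hr), ?_⟩, rfl⟩
    · rintro _ ⟨v, p, -, rfl⟩
      exact B.pathLen_nonneg p
    · rw [show B.pathClass (q ++ r.map h.onDart) = B.pathClass q * B.pathClass (r.map h.onDart)
        from FreeGroup.mul_mk.symm, ← Homothety.onClass_mk, ← Homothety.onClass_mk, hw w, ← hrep]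
      simp [mul_assoc]

lemma Equivalent.exists_translationLength {A B : MarkedGraph n} (hAB : Equivalent A B) :
    ∃ c : ℝ, 0 < c ∧ ∀ w, B.translationLength w = c * A.translationLength w := by
  obtain ⟨h, hc⟩ := hAB
  refine ⟨h.ratio, h.ratio_pos, fun w => le_antisymm (hc.translationLength_le w) ?_⟩
  have h1 : A.translationLength w ≤ h.ratio⁻¹ * B.translationLength w :=
    hc.symm.translationLength_le w
  rwa [← div_eq_inv_mul, le_div_iff₀' h.ratio_pos] at h1

/-- The right hand factor `Λ_R(A, B) = sup_{w ≠ 1} l_B(w) / l_A(w)`, with values in `[0, ∞]`. -/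
noncomputable def lambdaR (A B : MarkedGraph n) : ℝ≥0∞ :=
  ⨆ (w : FreeGroup (Fin n)) (_ : w ≠ 1),
    ENNReal.ofReal (B.translationLength w / A.translationLength w)

/-- The left hand factor `Λ_L(A, B) = sup_{w ≠ 1} l_A(w) / l_B(w)`, with values in `[0, ∞]`. -/
noncomputable def lambdaL (A B : MarkedGraph n) : ℝ≥0∞ :=
  ⨆ (w : FreeGroup (Fin n)) (_ : w ≠ 1),
    ENNReal.ofReal (A.translationLength w / B.translationLength w)

/-- `Λ(A, B) = Λ_R(A, B) Λ_L(A, B)`. -/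
noncomputable def lambda (A B : MarkedGraph n) : ℝ≥0∞ := lambdaR A B * lambdaL A B

lemma lambda_comm (A B : MarkedGraph n) : lambda A B = lambda B A := mul_comm _ _

lemma lambda_congr_right (A : MarkedGraph n) {B C : MarkedGraph n} (h : Equivalent B C) :
    lambda A B = lambda A C := by
  obtain ⟨c, hc, hl⟩ := h.exists_translationLength
  have h1 : lambdaR A C = ENNReal.ofReal c * lambdaR A B := by
    simp only [lambdaR, ENNReal.mul_iSup, hl, mul_div_assoc, ENNReal.ofReal_mul hc.le]
  have h2 : lambdaL A C = ENNReal.ofReal c⁻¹ * lambdaL A B := by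
    simp only [lambdaL, ENNReal.mul_iSup, ← ENNReal.ofReal_mul (inv_pos.2 hc).le, hl]
    refine iSup_congr fun w => iSup_congr fun _ => congrArg ENNReal.ofReal ?_
    rw [div_mul_eq_div_div, div_right_comm, div_eq_inv_mul]
  have h3 : ENNReal.ofReal c * ENNReal.ofReal c⁻¹ = 1 := by
    rw [← ENNReal.ofReal_mul hc.le, mul_inv_cancel₀ hc.ne', ENNReal.ofReal_one]
  rw [lambda, lambda, h1, h2, mul_mul_mul_comm, h3, one_mul]

end MarkedGraph

/-- Homothety of real functions on the free group: one is a positive multiple of the other. -/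
instance homothetySetoid (n : ℕ) : Setoid (FreeGroup (Fin n) → ℝ) where
  r f g := ∃ c : ℝ, 0 < c ∧ ∀ w, g w = c * f w
  iseqv := by
    refine ⟨fun f => ⟨1, one_pos, by simp⟩, ?_, ?_⟩
    · rintro f g ⟨c, hc, h⟩
      exact ⟨c⁻¹, inv_pos.2 hc, fun w => by rw [h w, inv_mul_cancel_left₀ hc.ne']⟩
    · rintro f g k ⟨c, hc, h⟩ ⟨b, hb, h'⟩
      exact ⟨b * c, mul_pos hb hc, fun w => by rw [h' w, h w, mul_assoc]⟩

/-- Projectivised functions on the free group, `ℝ^{F_n}` modulo homothety, with the quotient of the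
product topology. -/
abbrev ProjectiveFunctions (n : ℕ) : Type := Quotient (homothetySetoid n)

/-- Culler-Vogtmann space of rank `n`: marked metric graphs of rank `n` up to equivalence. -/
def CV (n : ℕ) : Type 1 := Quotient (MarkedGraph.setoid n)

namespace CV

/-- The projective class of the translation length function. -/
noncomputable def lengthFunction {n : ℕ} (A : CV n) : ProjectiveFunctions n :=
  Quotient.lift
    (fun A : MarkedGraph n => (Quotient.mk _ A.translationLength : ProjectiveFunctions n))
    (fun _ _ h => Quotient.sound (MarkedGraph.Equivalent.exists_translationLength h)) A

/-- The usual topology: the one induced by the map to projectivised length functions. -/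
@[reducible] noncomputable def lengthTopology (n : ℕ) : TopologicalSpace (CV n) :=
  TopologicalSpace.induced lengthFunction inferInstance

/-- The symmetric distance `d(A, B) = log Λ(A, B)`, a priori with values in `[-∞, ∞]`. -/
noncomputable def d {n : ℕ} (A B : CV n) : EReal :=
  Quotient.lift₂ (fun A B : MarkedGraph n => ENNReal.log (MarkedGraph.lambda A B))
    (fun A B A' B' hA hB => by
      rw [MarkedGraph.lambda_congr_right A hB, MarkedGraph.lambda_comm,
        MarkedGraph.lambda_congr_right B' hA, MarkedGraph.lambda_comm]) A B

/-- The topology induced by `d`: a set is open if and only if it contains, with each of its points,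
a `d`-ball of positive radius around that point. -/
@[reducible] def metricTopology (n : ℕ) : TopologicalSpace (CV n) where
  IsOpen U := ∀ A ∈ U, ∃ ε : ℝ, 0 < ε ∧ ∀ B, d A B < (ε : EReal) → B ∈ U
  isOpen_univ := fun _ _ => ⟨1, one_pos, fun _ _ => trivial⟩
  isOpen_inter := by
    rintro U W hU hW A ⟨hAU, hAW⟩
    obtain ⟨ε, hε, h⟩ := hU A hAU
    obtain ⟨δ, hδ, h'⟩ := hW A hAW
    refine ⟨min ε δ, lt_min hε hδ, fun B hB => ⟨h B (hB.trans_le ?_), h' B (hB.trans_le ?_)⟩⟩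
    · exact EReal.coe_le_coe_iff.2 (min_le_left _ _)
    · exact EReal.coe_le_coe_iff.2 (min_le_right _ _)
  isOpen_sUnion := by
    intro S hS A hA
    obtain ⟨U, hU, hAU⟩ := hA
    obtain ⟨ε, hε, h⟩ := hS U hU A hAU
    exact ⟨ε, hε, fun B hB => ⟨U, hU, h B hB⟩⟩

end CV

/-! One inclusion is soft. If Λ_R Λ_L < e^ε and c = Λ_L, then c·l_B differs from l_A by at most (e^ε
− 1)·l_A at every element, so it lies in a given product neighbourhood of l_A once ε is small.

The other inclusion requires that closeness of c·l_B to l_A on a suitable finite set W forces all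
ratios c·l_B(u)/l_A(u) with u ≠ 1 to be uniformly close to 1. The universal covers enter only
through displacement functions L with 0-hyperbolic Gromov products, whose growth along powers of g
is governed by l g (`IsTreeLength`); for A one also uses proper discontinuity and the chains of
`HasChains`.

From translation lengths to displacements (`exists_abs_sub_le`): high powers p, q of two basis
elements play ping-pong in both trees, and then L g is, up to a bounded error, the largest of the
numbers l (g t) with t among 1, p, p⁻¹, q, q⁻¹. So the displacements L and L' agree up to a constant
C on any prescribed finite set S, and C does not depend on S. The base point of the second tree is
taken on the axis of one basis element, near the axis of the other.

From local to global (`abs_sub_le_of_hasChains`): every g is a product of elements of displacement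
about R with bounded cancellation between neighbours, up to a bounded remainder. With S a ball of
radius slightly above 2R, each factor contributes an error bounded independently of R, hence a small
proportion of R. So L and L' agree up to a factor 1 + ε and an additive constant, and passing to
powers removes the constant for l and l' (`exists_forall_translation_le`). -/

/-! ### Gromov products and displacements on trees. -/

/-- The Gromov product `(g x | h x)` based at `x`, where `L g` is the distance from `x` to `g x`. -/
noncomputable def gromovProduct {G : Type*} [Group G] (L : G → ℝ) (g h : G) : ℝ :=
  (L g + L h - L (g⁻¹ * h)) / 2

/-- `L` behaves like the displacement `g ↦ d(x, g x)` of a point `x` and `l` like the translation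
length of an action of the group `G` by isometries on a tree. -/
structure IsTreeLength {G : Type*} [Group G] (L l : G → ℝ) : Prop where
  one : L 1 = 0
  inv : ∀ g, L g⁻¹ = L g
  hyp : ∀ g h k, min (gromovProduct L g h) (gromovProduct L h k) ≤ gromovProduct L g k
  pow_ge : ∀ g (k : ℕ), k * l g ≤ L (g ^ k)
  pow_le : ∀ g (k : ℕ), L (g ^ (k + 1)) ≤ k * l g + L g

/-- The device that discards additive constants: an estimate for all powers of g is divided by the
exponent. -/
lemma le_of_forall_nat_mul_le {x y C : ℝ} (h : ∀ k : ℕ, k * x ≤ k * y + C) : x ≤ y := by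
  by_contra! hxy
  obtain ⟨k, hk⟩ := exists_nat_gt (C / (x - y))
  rw [div_lt_iff₀ (by linarith)] at hk
  linarith [h k]

namespace IsTreeLength

variable {G : Type*} [Group G] {L l : G → ℝ}

lemma gp_comm (hL : IsTreeLength L l) (g h : G) : gromovProduct L g h = gromovProduct L h g := by
  have : L (h⁻¹ * g) = L (g⁻¹ * h) := by rw [← hL.inv]; simp
  simp only [gromovProduct, this]; ring

lemma gp_self (hL : IsTreeLength L l) (g : G) : gromovProduct L g g = L g := by
  simp [gromovProduct, hL.one]

lemma gp_nonneg (hL : IsTreeLength L l) (g h : G) : 0 ≤ gromovProduct L g h := by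
  have h1 := hL.hyp g 1 h
  have h2 : gromovProduct L g 1 = 0 := by simp [gromovProduct, hL.one, hL.inv]
  have h3 : gromovProduct L 1 h = 0 := by simp [gromovProduct, hL.one]
  simpa [h2, h3] using h1

lemma nonneg (hL : IsTreeLength L l) (g : G) : 0 ≤ L g := by
  rw [← hL.gp_self]; exact hL.gp_nonneg g g

lemma mul_eq (L : G → ℝ) (hi : ∀ g, L g⁻¹ = L g) (g h : G) :
    L (g * h) = L g + L h - 2 * gromovProduct L g⁻¹ h := by
  simp only [gromovProduct, inv_inv, hi]; ring

lemma gp_mul (L : G → ℝ) (hi : ∀ g, L g⁻¹ = L g) (g h : G) :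
    gromovProduct L g (g * h) = L g - gromovProduct L g⁻¹ h := by
  simp only [gromovProduct, inv_inv, hi, inv_mul_cancel_left]; ring

lemma mul_le (hL : IsTreeLength L l) (g h : G) : L (g * h) ≤ L g + L h := by
  rw [mul_eq L hL.inv]; linarith [hL.gp_nonneg g⁻¹ h]

lemma gp_le_left (hL : IsTreeLength L l) (g h : G) : gromovProduct L g h ≤ L g := by
  have h1 := gp_mul L hL.inv g (g⁻¹ * h)
  rw [mul_inv_cancel_left] at h1
  linarith [hL.gp_nonneg g⁻¹ (g⁻¹ * h)]

lemma le_mul (hL : IsTreeLength L l) (g h : G) : L g - L h ≤ L (g * h) := by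
  rw [mul_eq L hL.inv, hL.gp_comm]; linarith [hL.gp_le_left h g⁻¹]

lemma le_length (hL : IsTreeLength L l) (g : G) : l g ≤ L g := by simpa using hL.pow_ge g 1

lemma translation_nonneg (hL : IsTreeLength L l) (g : G) : 0 ≤ l g := by
  refine le_of_forall_nat_mul_le (C := L g) fun k => ?_
  linarith [hL.nonneg (g ^ (k + 1)), hL.pow_le g k]

lemma pow_le' (hL : IsTreeLength L l) (g : G) (k : ℕ) : L (g ^ k) ≤ k * l g + L g := by
  cases k with
  | zero => simpa [hL.one] using hL.nonneg g
  | succ k =>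
    have := hL.pow_le g k
    have := hL.translation_nonneg g
    push_cast; linarith

/-- The left side is L (g²) − L g, so this is the growth bound for the square: an element with
little cyclic cancellation translates almost as far as it displaces. -/
lemma sub_gp_le (hL : IsTreeLength L l) (g : G) : L g - 2 * gromovProduct L g⁻¹ g ≤ l g := by
  have := hL.pow_le g 1
  rw [show g ^ (1 + 1) = g * g from pow_two g, mul_eq L hL.inv] at this
  push_cast at this; linarith

lemma translation_le_conj (hL : IsTreeLength L l) (c g : G) : l (c * g * c⁻¹) ≤ l g := by
  refine le_of_forall_nat_mul_le (C := L g + 2 * L c) fun k => ?_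
  have h1 := hL.pow_ge (c * g * c⁻¹) k
  rw [conj_pow] at h1
  have h2 := hL.mul_le (c * g ^ k) c⁻¹
  have h3 := hL.mul_le c (g ^ k)
  rw [hL.inv] at h2
  linarith [hL.pow_le' g k]

lemma translation_conj (hL : IsTreeLength L l) (c g : G) : l (c * g * c⁻¹) = l g := by
  refine le_antisymm (hL.translation_le_conj c g) ?_
  have := hL.translation_le_conj c⁻¹ (c * g * c⁻¹)
  simpa [mul_assoc] using this

/-- Moving the base point. -/
lemma conj (hL : IsTreeLength L l) (c : G) : IsTreeLength (fun g => L (c⁻¹ * g * c)) l where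
  one := by simpa using hL.one
  inv g := by rw [← hL.inv]; simp [mul_assoc]
  hyp g h k := by
    have key : ∀ g h, gromovProduct (fun g => L (c⁻¹ * g * c)) g h =
        gromovProduct L (c⁻¹ * g * c) (c⁻¹ * h * c) := fun g h => by
      simp only [gromovProduct]; congr 3; group
    simp only [key]; exact hL.hyp _ _ _
  pow_ge g k := by
    have h := hL.pow_ge (c⁻¹ * g * c) k
    have h1 := hL.translation_conj c⁻¹ g
    have h2 := conj_pow (i := k) (a := c⁻¹) (b := g)
    rw [inv_inv] at h1 h2
    rwa [h1, h2] at h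
  pow_le g k := by
    have h := hL.pow_le (c⁻¹ * g * c) k
    have h1 := hL.translation_conj c⁻¹ g
    have h2 := conj_pow (i := k + 1) (a := c⁻¹) (b := g)
    rw [inv_inv] at h1 h2
    rwa [h1, h2] at h

/-- Rescaling the metric. -/
lemma const_mul (hL : IsTreeLength L l) {c : ℝ} (hc : 0 < c) :
    IsTreeLength (fun g => c * L g) (fun g => c * l g) where
  one := by simp [hL.one]
  inv g := by rw [hL.inv]
  hyp g h k := by
    have key : ∀ g h, gromovProduct (fun g => c * L g) g h = c * gromovProduct L g h := fun g h => by
      simp only [gromovProduct]; ring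
    simp only [key, ← mul_min_of_nonneg _ _ hc.le]
    exact mul_le_mul_of_nonneg_left (hL.hyp _ _ _) hc.le
  pow_ge g k := by
    have := mul_le_mul_of_nonneg_left (hL.pow_ge g k) hc.le
    linarith
  pow_le g k := by
    have := mul_le_mul_of_nonneg_left (hL.pow_le g k) hc.le
    linarith

/-- In a tree, if g and h stay together beyond κ and f has left g by then, f has left h too. -/
lemma gp_le_of_gp_lt (hL : IsTreeLength L l) {f g h : G} {κ : ℝ} (h1 : gromovProduct L f g ≤ κ)
    (h2 : κ < gromovProduct L g h) : gromovProduct L f h ≤ κ := by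
  have := hL.hyp f h g
  rw [hL.gp_comm h g] at this
  rcases min_le_iff.1 this with h | h <;> linarith

/-- A lower bound for the translation length of a product without much cancellation. -/
lemma le_translation_mul (hL : IsTreeLength L l) {g t : G} {C : ℝ}
    (h1 : gromovProduct L t g⁻¹ ≤ C) (h2 : gromovProduct L t⁻¹ g ≤ C) (hg : 2 * C < L g)
    (ht : 2 * C < L t) : L g + L t - 4 * C ≤ l (g * t) := by
  have e1 : gromovProduct L g (g * t) = L g - gromovProduct L g⁻¹ t := gp_mul L hL.inv g t
  have e2 : gromovProduct L t⁻¹ (t⁻¹ * g⁻¹) = L t - gromovProduct L t g⁻¹ := by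
    have := gp_mul L hL.inv t⁻¹ g⁻¹
    rwa [inv_inv, hL.inv] at this
  rw [hL.gp_comm g⁻¹ t] at e1
  -- The element g t follows g beyond C and its inverse follows t⁻¹ beyond C, while g and t⁻¹ part
  -- before C; so g t has cyclic cancellation at most C.
  have h3 : gromovProduct L t⁻¹ (g * t) ≤ C := hL.gp_le_of_gp_lt h2 (by linarith)
  have h4 : gromovProduct L (g * t) (t⁻¹ * g⁻¹) ≤ C :=
    hL.gp_le_of_gp_lt (by rwa [hL.gp_comm]) (by linarith)
  have h5 := hL.sub_gp_le (g * t)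
  rw [mul_inv_rev, hL.gp_comm, mul_eq L hL.inv g t, hL.gp_comm g⁻¹ t] at h5
  linarith

/-- Given two independent elements, the displacement of any `g` is, up to a constant, the
translation length of a product of `g` with one of finitely many elements. -/
lemma exists_le_translation_mul (hL : IsTreeLength L l) {p q : G} {C : ℝ}
    (hp : gromovProduct L p p⁻¹ ≤ C) (hq : gromovProduct L q q⁻¹ ≤ C)
    (h1 : gromovProduct L p q ≤ C) (h2 : gromovProduct L p q⁻¹ ≤ C)
    (h3 : gromovProduct L p⁻¹ q ≤ C) (h4 : gromovProduct L p⁻¹ q⁻¹ ≤ C)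
    (hLp : 2 * C < L p) (hLq : 2 * C < L q) (g : G) :
    ∃ t ∈ ({1, p, p⁻¹, q, q⁻¹} : Set G), L g ≤ l (g * t) + 4 * C := by
  have hC : 0 ≤ C := (hL.gp_nonneg _ _).trans hp
  rcases le_or_gt (L g) (2 * C) with hg | hg
  · exact ⟨1, by simp, by linarith [hL.translation_nonneg (g * 1)]⟩
  have step : ∀ t, 2 * C < L t → gromovProduct L t g⁻¹ ≤ C → gromovProduct L t⁻¹ g ≤ C →
      L g ≤ l (g * t) + 4 * C := fun t ht ha hb => by
    linarith [hL.le_translation_mul ha hb hg ht]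
  -- Two directions that part before C cannot both be followed beyond C by the same x.
  have excl : ∀ s t x, gromovProduct L s t ≤ C → gromovProduct L s x ≤ C ∨
      gromovProduct L t x ≤ C := fun s t x hst => by
    by_contra! h
    have := hL.hyp s x t
    rw [hL.gp_comm x t] at this
    exact absurd (lt_min h.1 h.2) (not_lt.2 (this.trans hst))
  have hLp' : 2 * C < L p⁻¹ := by rwa [hL.inv]
  have hLq' : 2 * C < L q⁻¹ := by rwa [hL.inv]
  have s1 := step p hLp
  have s2 := step p⁻¹ hLp'
  have s3 := step q hLq
  have s4 := step q⁻¹ hLq'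
  rw [inv_inv] at s2 s4
  simp only [Set.mem_insert_iff, Set.mem_singleton_iff, exists_eq_or_imp, exists_eq_left]
  have a1 := excl _ _ g⁻¹ hp
  have a2 := excl _ _ g⁻¹ hq
  have a3 := excl _ _ g⁻¹ h1
  have a4 := excl _ _ g⁻¹ h2
  have a5 := excl _ _ g⁻¹ h3
  have a6 := excl _ _ g⁻¹ h4
  have b1 := excl _ _ g hp
  have b2 := excl _ _ g hq
  have b3 := excl _ _ g h1
  have b4 := excl _ _ g h2
  have b5 := excl _ _ g h3
  have b6 := excl _ _ g h4
  right
  clear step excl hp hq h1 h2 h3 h4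
  -- If neither p nor p⁻¹ is a valid t, then g and g⁻¹ both follow the same one of the directions p,
  -- p⁻¹. Hence neither follows q or q⁻¹, and t = q works.
  by_cases x1 : gromovProduct L p g⁻¹ ≤ C <;> by_cases x2 : gromovProduct L p⁻¹ g⁻¹ ≤ C <;>
  by_cases x3 : gromovProduct L p⁻¹ g ≤ C <;> by_cases x4 : gromovProduct L p g ≤ C <;>
  simp only [x1, x2, x3, x4, true_or, or_true, false_or, or_false, forall_const, false_imp_iff,
    or_self] at * <;> simp [*]

end IsTreeLength

/-! ### Axes of two elements, and displacements recovered from translation lengths. -/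

namespace IsTreeLength

variable {G : Type*} [Group G] {L l : G → ℝ}

/-- Otherwise b and b⁻¹ both begin along the whole segment from x to a x, and conjugating by a
shortens the displacement of b by at least 2 L a. -/
lemma gp_lt_of_le_conj (hL : IsTreeLength L l) {a b : G} (hb : 2 * L a < gromovProduct L b b⁻¹)
    (ha : 0 < L a) (h : L b ≤ L (a⁻¹ * b * a) + L a) : gromovProduct L b a < L a := by
  by_contra! hba
  have h0 := hL.gp_le_left b b⁻¹
  have h1 := hL.gp_le_left a b
  have h2 := hL.hyp b⁻¹ b a
  have h3 := mul_eq L hL.inv a⁻¹ b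
  have h4 := mul_eq L hL.inv (a⁻¹ * b) a
  have h5 := gp_mul L hL.inv b⁻¹ a
  have h6 := hL.hyp (b⁻¹ * a) b⁻¹ a
  rw [hL.gp_comm b⁻¹ b] at h2
  rw [hL.gp_comm (b⁻¹ * a) b⁻¹] at h6
  simp only [mul_inv_rev, inv_inv, hL.inv, hL.gp_comm a b] at h1 h3 h4 h5
  have h7 := (le_min (by linarith : L a ≤ _) hba).trans h2
  have h8 := (le_min (by linarith : L a ≤ _) h7).trans h6
  linarith

/-- Nothing cancels in a * b, and the cyclic cancellation of a * b is at most the Gromov product of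
b and a, hence less than L a. -/
lemma le_translation_mul_of_gp (hL : IsTreeLength L l) {a b : G}
    (hb : 2 * L a < gromovProduct L b b⁻¹) (h1 : gromovProduct L b a < L a)
    (h2 : gromovProduct L b a⁻¹ ≤ 0) : L b ≤ l (a * b) + L a := by
  have h0 := hL.gp_le_left b b⁻¹
  have hn := hL.nonneg a
  have h3 : gromovProduct L a b⁻¹ ≤ gromovProduct L b a :=
    hL.gp_le_of_gp_lt (g := b) (by rw [hL.gp_comm]) (by linarith)
  have h4 := mul_eq L hL.inv a b
  have h5 := gp_mul L hL.inv a b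
  have h6 := gp_mul L hL.inv b⁻¹ a⁻¹
  rw [hL.gp_comm a⁻¹ b] at h4 h5
  rw [inv_inv, hL.inv] at h6
  have h7 : gromovProduct L b⁻¹ (a * b) ≤ gromovProduct L b a :=
    hL.gp_le_of_gp_lt (g := a) (by rwa [hL.gp_comm]) (by linarith)
  have h8 : gromovProduct L (a * b) (b⁻¹ * a⁻¹) ≤ gromovProduct L b a :=
    hL.gp_le_of_gp_lt (g := b⁻¹) (by rwa [hL.gp_comm]) (by linarith)
  have h9 := hL.sub_gp_le (a * b)
  rw [hL.gp_comm, mul_inv_rev] at h9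
  linarith

/-- If the base point lies on the axis of `a` and, up to a translation of the axis, is as close as
possible to the axis of `b`, then translation lengths control the displacement under `b`. -/
lemma length_le_of_le_conj (hL : IsTreeLength L l) {a b : G} (ha : L a = l a) (hpos : 0 < l a)
    (h1 : L b ≤ L (a⁻¹ * b * a) + L a) (h2 : L b ≤ L (a * b * a⁻¹) + L a) :
    L b ≤ max (l b) (max (l (a * b)) (l (a⁻¹ * b))) + 4 * l a := by
  rw [← ha] at hpos ⊢
  rcases le_or_gt (gromovProduct L b b⁻¹) (2 * L a) with hb | hb
  · have := hL.sub_gp_le b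
    rw [hL.gp_comm] at this
    linarith [le_max_left (l b) (max (l (a * b)) (l (a⁻¹ * b)))]
  have h3 := hL.gp_lt_of_le_conj hb hpos h1
  have h4 : gromovProduct L b a⁻¹ < L a⁻¹ :=
    hL.gp_lt_of_le_conj (by rwa [hL.inv]) (by rwa [hL.inv]) (by rwa [inv_inv, hL.inv])
  -- Since x lies on the axis of a, the directions of a and a⁻¹ part at x. So b leaves at least one
  -- of them at once, which decides between a * b and a⁻¹ * b.
  have h5 : gromovProduct L a a⁻¹ ≤ 0 := by
    have := hL.pow_ge a 2
    have h6 := mul_eq L hL.inv a a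
    rw [hL.gp_comm, ← pow_two] at h6
    push_cast at this
    linarith
  have h6 := (hL.hyp a b a⁻¹).trans h5
  rw [hL.gp_comm a b] at h6
  rcases min_le_iff.1 h6 with h | h
  · have := hL.le_translation_mul_of_gp (a := a⁻¹) (b := b) (by rwa [hL.inv]) h4 (by rwa [inv_inv])
    rw [hL.inv] at this
    have := (le_max_right (l (a * b)) (l (a⁻¹ * b))).trans (le_max_right (l b) _)
    linarith
  · have := hL.le_translation_mul_of_gp hb h3 h
    have := (le_max_left (l (a * b)) (l (a⁻¹ * b))).trans (le_max_right (l b) _)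
    linarith

lemma exists_length_le {a b : G} (hT : ∃ L, IsTreeLength L l ∧ L a = l a) (ha : 0 < l a) :
    ∃ L, IsTreeLength L l ∧ L a = l a ∧
      L b ≤ max (l b) (max (l (a * b)) (l (a⁻¹ * b))) + 4 * l a := by
  obtain ⟨L, hL, hLa⟩ := hT
  let f : ℤ → ℝ := fun j => L ((a ^ j)⁻¹ * b * a ^ j)
  have hbdd : BddBelow (Set.range f) := ⟨0, by rintro _ ⟨j, rfl⟩; exact hL.nonneg _⟩
  -- A minimiser up to the error l a suffices, so the infimum need not be attained. Moving the base
  -- point by powers of a keeps it on the axis of a.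
  obtain ⟨j, hj⟩ := exists_lt_of_ciInf_lt (lt_add_of_pos_right (⨅ j, f j) ha)
  have hmin : ∀ i, f j ≤ f i + l a := fun i => by linarith [ciInf_le hbdd i]
  have hLa' : L ((a ^ j)⁻¹ * a * a ^ j) = l a := by
    rw [← hLa]; congr 1; group
  refine ⟨_, hL.conj (a ^ j), hLa', (hL.conj (a ^ j)).length_le_of_le_conj hLa' ha ?_ ?_⟩
  · have := hmin (j + 1)
    simp only [f] at this
    rw [hLa']
    convert this using 3
    group
  · have := hmin (j - 1)
    simp only [f] at this
    rw [hLa']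
    convert this using 3
    group

/-- In a properly discontinuous action the axes of independent elements have bounded overlap. -/
lemma exists_gp_pow_le (hL : IsTreeLength L l) (hfin : ∀ R, {g | L g ≤ R}.Finite) {a b : G}
    (hab : ∀ i : ℕ, i ≠ 0 → ¬ Commute (a ^ i) b) :
    ∃ C, ∀ k m : ℕ, gromovProduct L (a ^ k) (b ^ m) ≤ C := by
  by_contra! h
  have hn := hL.nonneg a
  have hnb := hL.nonneg b
  have hla := hL.le_length a
  -- If the overlaps are unbounded, a^i x lies close to a long segment that b moves nearly along
  -- itself, so b displaces a^i x by an amount bounded independently of i.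
  have key : ∀ i : ℕ, (a ^ i)⁻¹ * b * a ^ i ∈ {g | L g ≤ 3 * L b + 3 * L a} := fun i => by
    obtain ⟨k, m, hkm⟩ := h ((i + 1) * L a)
    have hik : i ≤ k := by
      by_contra! hki
      have h1 := hL.gp_le_left (a ^ k) (b ^ m)
      have h2 := hL.pow_le' a k
      have h3 : (k : ℝ) + 1 ≤ i := by exact_mod_cast hki
      have h4 : (k : ℝ) * l a ≤ k * L a := by gcongr
      nlinarith
    obtain ⟨j, rfl⟩ := Nat.exists_eq_add_of_le hik
    have h1 : L (a ^ i) - 3 / 2 * L a ≤ gromovProduct L (a ^ i) (a ^ (i + j)) := by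
      have h2 := hL.pow_ge a (i + j)
      have h3 := hL.pow_le' a i
      have h4 := hL.pow_le' a j
      simp only [gromovProduct, pow_add, inv_mul_cancel_left]
      rw [← pow_add]
      push_cast at h2
      linarith
    have h2 : L (a ^ i) - 3 / 2 * L a ≤ gromovProduct L (a ^ i) (b ^ m) := by
      refine (le_min h1 ?_).trans (hL.hyp _ _ _)
      have h3 := hL.pow_le' a i
      have h4 : (i : ℝ) * l a ≤ i * L a := by gcongr
      linarith
    have h3 : L ((a ^ i)⁻¹ * b ^ m) ≤ L (b ^ m) - L (a ^ i) + 3 * L a := by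
      simp only [gromovProduct] at h2; linarith
    have h4 : L (b * b ^ m) ≥ L (b ^ m) - L b := by
      rw [← pow_succ', pow_succ]; exact hL.le_mul _ _
    have h5 := hL.hyp (a ^ i) (b * b ^ m) (b * a ^ i)
    simp only [Set.mem_ofPred_eq]
    rcases min_le_iff.1 h5 with h6 | h6
    · have h7 := hL.mul_le b (a ^ i)
      have h8 : L ((a ^ i)⁻¹ * (b * b ^ m)) ≤ L ((a ^ i)⁻¹ * b ^ m) + L b := by
        rw [← pow_succ', pow_succ, ← mul_assoc]; exact hL.mul_le _ _
      simp only [gromovProduct, ← mul_assoc] at h6 h8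
      linarith
    · have h7 : L ((b * b ^ m)⁻¹ * (b * a ^ i)) = L ((a ^ i)⁻¹ * b ^ m) := by
        rw [← hL.inv]; congr 1; group
      simp only [gromovProduct] at h6
      rw [h7, ← mul_assoc (a ^ i)⁻¹] at h6
      linarith
  -- Proper discontinuity makes two of these conjugates equal, and then a nontrivial power of a
  -- commutes with b.
  obtain ⟨i, j, hij, he⟩ := (hfin (3 * L b + 3 * L a)).exists_lt_map_eq_of_forall_mem key
  obtain ⟨d, rfl⟩ := Nat.exists_eq_add_of_lt hij
  refine hab (d + 1) (by omega) ?_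
  have h1 : a ^ (i + d + 1) = a ^ (d + 1) * a ^ i := by rw [add_assoc, add_comm, pow_add]
  rw [h1] at he
  have h2 : b = (a ^ (d + 1))⁻¹ * b * a ^ (d + 1) := by
    have := congrArg (fun x => a ^ i * x * (a ^ i)⁻¹) he
    simpa [mul_assoc] using this
  change a ^ (d + 1) * b = b * a ^ (d + 1)
  nth_rw 1 [h2]
  simp [mul_assoc]

/-- `p` and `q` have long displacement and their axes leave the base point in four directions. -/
structure IsPingPong (L : G → ℝ) (p q : G) (C : ℝ) : Prop where
  left : gromovProduct L p p⁻¹ ≤ C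
  right : gromovProduct L q q⁻¹ ≤ C
  pp : gromovProduct L p q ≤ C
  pm : gromovProduct L p q⁻¹ ≤ C
  mp : gromovProduct L p⁻¹ q ≤ C
  mm : gromovProduct L p⁻¹ q⁻¹ ≤ C
  lt_left : 2 * C < L p
  lt_right : 2 * C < L q

/-- Every l (g t) is at most L g + M, and some l (g t) is at least L g − 4 C. The same holds for L'
and l', so comparing l' with l at these five elements compares L' with L. -/
lemma abs_sub_le_of_isPingPong {L' l' : G → ℝ} (hL : IsTreeLength L l) (hL' : IsTreeLength L' l')
    {p q g : G} {C M : ℝ} (h : IsPingPong L p q C) (h' : IsPingPong L' p q C)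
    (hp : L p ≤ M) (hq : L q ≤ M) (hp' : L' p ≤ M) (hq' : L' q ≤ M)
    (hl : ∀ t ∈ ({1, p, p⁻¹, q, q⁻¹} : Set G), |l' (g * t) - l (g * t)| ≤ 1) :
    |L' g - L g| ≤ 4 * C + M + 1 := by
  have hM : 0 ≤ M := (hL.nonneg p).trans hp
  have key : ∀ {L l : G → ℝ}, IsTreeLength L l → L p ≤ M → L q ≤ M →
      ∀ t ∈ ({1, p, p⁻¹, q, q⁻¹} : Set G), l (g * t) ≤ L g + M := by
    intro L l hL hp hq t ht
    refine (hL.le_length _).trans ((hL.mul_le _ _).trans (add_le_add_right ?_ _))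
    simp only [Set.mem_insert_iff, Set.mem_singleton_iff] at ht
    rcases ht with rfl | rfl | rfl | rfl | rfl <;> simp only [hL.inv, hL.one, hp, hq, hM]
  obtain ⟨t, ht, h1⟩ := hL.exists_le_translation_mul h.left h.right h.pp h.pm h.mp h.mm
    h.lt_left h.lt_right g
  obtain ⟨s, hs, h2⟩ := hL'.exists_le_translation_mul h'.left h'.right h'.pp h'.pm h'.mp h'.mm
    h'.lt_left h'.lt_right g
  have h3 := abs_le.1 (hl t ht)
  have h4 := abs_le.1 (hl s hs)
  have h5 := key hL hp hq s hs
  have h6 := key hL' hp' hq' t ht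
  rw [abs_le]
  constructor <;> linarith

/-- This allows ping-pong to be certified from a lower bound on a translation length, which carries
over to the second tree. -/
lemma gp_le_of_translation (hL : IsTreeLength L l) (g h : G) :
    gromovProduct L g h ≤ (L g + L h - l (g⁻¹ * h)) / 2 := by
  have := hL.le_length (g⁻¹ * h)
  simp only [gromovProduct]; linarith

lemma gp_pow_inv_le (hL : IsTreeLength L l) (a : G) (k : ℕ) :
    gromovProduct L (a ^ k) (a ^ k)⁻¹ ≤ L a := by
  have h1 := hL.pow_ge a (k + k)
  have h2 := hL.pow_le' a k
  have h3 : L ((a ^ k)⁻¹ * (a ^ k)⁻¹) = L (a ^ (k + k)) := by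
    rw [← hL.inv, pow_add]; simp
  simp only [gromovProduct, h3, hL.inv]
  push_cast at h1
  linarith

end IsTreeLength

namespace IsTreeLength

variable {G : Type*} [Group G] {L l : G → ℝ}

lemma exists_gp_zpow_le (hL : IsTreeLength L l) (hfin : ∀ R, {g | L g ≤ R}.Finite) {a b : G}
    (hab : ∀ i : ℕ, i ≠ 0 → ¬ Commute (a ^ i) b) :
    ∃ C, ∀ k : ℕ, gromovProduct L (a ^ k) (b ^ k) ≤ C ∧ gromovProduct L (a ^ k) (b ^ k)⁻¹ ≤ C ∧
      gromovProduct L (a ^ k)⁻¹ (b ^ k) ≤ C ∧ gromovProduct L (a ^ k)⁻¹ (b ^ k)⁻¹ ≤ C := by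
  obtain ⟨C₁, h₁⟩ := hL.exists_gp_pow_le hfin hab
  obtain ⟨C₂, h₂⟩ := hL.exists_gp_pow_le hfin (a := a) (b := b⁻¹)
    fun i hi => by rw [Commute.inv_right_iff]; exact hab i hi
  obtain ⟨C₃, h₃⟩ := hL.exists_gp_pow_le hfin (a := a⁻¹) (b := b)
    fun i hi => by rw [inv_pow, Commute.inv_left_iff]; exact hab i hi
  obtain ⟨C₄, h₄⟩ := hL.exists_gp_pow_le hfin (a := a⁻¹) (b := b⁻¹)
    fun i hi => by rw [inv_pow, Commute.inv_left_iff, Commute.inv_right_iff]; exact hab i hi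
  simp only [inv_pow] at h₂ h₃ h₄
  refine ⟨max (max C₁ C₂) (max C₃ C₄), fun k => ⟨?_, ?_, ?_, ?_⟩⟩
  · exact (h₁ k k).trans ((le_max_left _ _).trans (le_max_left _ _))
  · exact (h₂ k k).trans ((le_max_right _ _).trans (le_max_left _ _))
  · exact (h₃ k k).trans ((le_max_left _ _).trans (le_max_right _ _))
  · exact (h₄ k k).trans ((le_max_right _ _).trans (le_max_right _ _))

lemma isPingPong_pow (hL : IsTreeLength L l) {a b : G} {k : ℕ} {K C : ℝ} (ha : L a ≤ K)
    (hb : L b ≤ K) (hKC : K ≤ C)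
    (h1 : k * l a + k * l b + 2 * K - 2 * C ≤ l ((a ^ k)⁻¹ * b ^ k))
    (h2 : k * l a + k * l b + 2 * K - 2 * C ≤ l ((a ^ k)⁻¹ * (b ^ k)⁻¹))
    (h3 : k * l a + k * l b + 2 * K - 2 * C ≤ l (a ^ k * b ^ k))
    (h4 : k * l a + k * l b + 2 * K - 2 * C ≤ l (a ^ k * (b ^ k)⁻¹))
    (hka : 2 * C < k * l a) (hkb : 2 * C < k * l b) : IsPingPong L (a ^ k) (b ^ k) C := by
  have e1 := hL.pow_le' a k
  have e2 := hL.pow_le' b k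
  refine ⟨(hL.gp_pow_inv_le a k).trans (by linarith), (hL.gp_pow_inv_le b k).trans (by linarith),
    (hL.gp_le_of_translation _ _).trans ?_, (hL.gp_le_of_translation _ _).trans ?_,
    (hL.gp_le_of_translation _ _).trans ?_, (hL.gp_le_of_translation _ _).trans ?_,
    hka.trans_le (hL.pow_ge a k), hkb.trans_le (hL.pow_ge b k)⟩
  all_goals try simp only [inv_inv, hL.inv]
  all_goals linarith

/-- Bounded overlap of the axes makes translation length almost additive on products of powers of a
and b, with a defect independent of the exponent. -/
lemma exists_translation_pow_ge (hL : IsTreeLength L l) (hfin : ∀ R, {g | L g ≤ R}.Finite)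
    {a b : G} (hab : ∀ i : ℕ, i ≠ 0 → ¬ Commute (a ^ i) b) :
    ∃ D ≥ 0, ∀ k : ℕ, 2 * D < k * l a → 2 * D < k * l b →
      k * l a + k * l b - 4 * D ≤ l ((a ^ k)⁻¹ * b ^ k) ∧
      k * l a + k * l b - 4 * D ≤ l ((a ^ k)⁻¹ * (b ^ k)⁻¹) ∧
      k * l a + k * l b - 4 * D ≤ l (a ^ k * b ^ k) ∧
      k * l a + k * l b - 4 * D ≤ l (a ^ k * (b ^ k)⁻¹) := by
  obtain ⟨D, hD⟩ := hL.exists_gp_zpow_le hfin hab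
  refine ⟨D, (hL.gp_nonneg _ _).trans (hD 0).1, fun k hka hkb => ?_⟩
  obtain ⟨d1, d2, d3, d4⟩ := hD k
  have hp := hL.pow_ge a k
  have hq := hL.pow_ge b k
  have key : ∀ g t, gromovProduct L g⁻¹ t ≤ D → gromovProduct L g t⁻¹ ≤ D → L g = L (a ^ k) →
      L t = L (b ^ k) → k * l a + k * l b - 4 * D ≤ l (g * t) := fun g t h1 h2 h3 h4 => by
    have := hL.le_translation_mul (g := g) (t := t) (C := D) (by rwa [hL.gp_comm])
      (by rwa [hL.gp_comm]) (by linarith) (by linarith)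
    linarith
  refine ⟨key _ _ ?_ ?_ ?_ ?_, key _ _ ?_ ?_ ?_ ?_, key _ _ ?_ ?_ ?_ ?_, key _ _ ?_ ?_ ?_ ?_⟩ <;>
    simp only [inv_inv, hL.inv, d1, d2, d3, d4]

/-- If finitely many translation lengths of two actions on trees are close, then the displacements
of suitable base points agree up to a constant on a prescribed finite set. -/
theorem exists_abs_sub_le (hL : IsTreeLength L l) (hfin : ∀ R, {g | L g ≤ R}.Finite) {a b : G}
    (hab : ∀ i : ℕ, i ≠ 0 → ¬ Commute (a ^ i) b) (ha : 0 < l a) (hb : 0 < l b) :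
    ∃ C, ∀ S : Finset G, ∃ W : Finset G, ∃ δ > 0, ∀ l' : G → ℝ,
      (∃ L', IsTreeLength L' l' ∧ L' a = l' a) → (∀ w ∈ W, |l' w - l w| ≤ δ) →
      ∃ L', IsTreeLength L' l' ∧ ∀ g ∈ S, |L' g - L g| ≤ C := by
  classical
  obtain ⟨D, hD0, hD⟩ := hL.exists_translation_pow_ge hfin hab
  have n1 := hL.translation_nonneg (a * b)
  have n2 := hL.translation_nonneg (a⁻¹ * b)
  have n3 := hL.nonneg a
  have n4 := hL.nonneg b
  -- K bounds the displacements of a and b in both trees: it dominates the bound of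
  -- `exists_length_le`, the summand 5 absorbing the perturbation since δ ≤ 1.
  obtain ⟨K, hK⟩ : ∃ K, K = l b + l (a * b) + l (a⁻¹ * b) + 4 * l a + 5 + L a + L b := ⟨_, rfl⟩
  -- With this C, `isPingPong_pow` tolerates a defect of 4 D + 2. The reference tree has defect at
  -- most 4 D, and the perturbation adds at most 2 k δ + δ = 1. All of k, C, M and δ are fixed
  -- before S.
  obtain ⟨C, hC⟩ : ∃ C, C = 2 * D + K + 1 := ⟨_, rfl⟩
  obtain ⟨k, hk⟩ := exists_nat_gt (max ((2 * C + 1) / l a) ((2 * C + 1) / l b))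
  have hka : 2 * C + 1 < k * l a := (div_lt_iff₀ ha).1 ((le_max_left _ _).trans_lt hk)
  have hkb : 2 * C + 1 < k * l b := (div_lt_iff₀ hb).1 ((le_max_right _ _).trans_lt hk)
  clear hk
  obtain ⟨t1, t2, t3, t4⟩ := hD k (by linarith) (by linarith)
  clear hD
  have hpp : IsPingPong L (a ^ k) (b ^ k) C :=
    hL.isPingPong_pow (K := K) (by linarith) (by linarith) (by linarith) (by linarith)
      (by linarith) (by linarith) (by linarith) (by linarith) (by linarith)
  obtain ⟨M, hM⟩ : ∃ M, M = k * l a + k * l b + K + 1 := ⟨_, rfl⟩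
  have hpM : L (a ^ k) ≤ M := (hL.pow_le' a k).trans (by linarith)
  have hqM : L (b ^ k) ≤ M := (hL.pow_le' b k).trans (by linarith)
  have hk0 : (0 : ℝ) ≤ k := Nat.cast_nonneg k
  obtain ⟨δ, hδ0, hkδ⟩ : ∃ δ : ℝ, 0 < δ ∧ 2 * (k * δ) + δ = 1 :=
    ⟨1 / (2 * k + 1), by positivity, by field_simp⟩
  generalize hp : a ^ k = p at *
  generalize hq : b ^ k = q at *
  let W₁ : List G := [a, b, a * b, a⁻¹ * b, p⁻¹ * q, p⁻¹ * q⁻¹, p * q, p * q⁻¹]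
  let T : Finset G := {1, p, p⁻¹, q, q⁻¹}
  refine ⟨4 * C + M + 1, fun S => ⟨W₁.toFinset ∪ S.biUnion fun g => T.image (g * ·), δ, hδ0,
    fun l' hT hW => ?_⟩⟩
  have hW₁ : ∀ w ∈ W₁, |l' w - l w| ≤ δ := fun w hw =>
    hW w (Finset.mem_union_left _ (List.mem_toFinset.2 hw))
  simp only [W₁, List.forall_mem_cons, abs_le] at hW₁
  obtain ⟨wa, wb, wab, wab', w1, w2, w3, w4, -⟩ := hW₁
  have kl : ∀ x y : ℝ, x ≤ y + δ → k * x ≤ k * y + k * δ := fun x y hxy => by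
    rw [← mul_add]; exact mul_le_mul_of_nonneg_left hxy hk0
  have ka := kl (l' a) (l a) (by linarith)
  have kb := kl (l' b) (l b) (by linarith)
  have ka' := kl (l a) (l' a) (by linarith)
  have kb' := kl (l b) (l' b) (by linarith)
  have hkδ0 : 0 ≤ k * δ := by positivity
  have ha' : 0 < l' a := pos_of_mul_pos_right (by linarith : 0 < k * l' a) hk0
  obtain ⟨L', hL', e1, e2⟩ := exists_length_le (b := b) hT ha'
  have hLa : L' a ≤ K := by linarith
  have hLb : L' b ≤ K := by
    refine e2.trans ?_
    have : max (l' b) (max (l' (a * b)) (l' (a⁻¹ * b))) ≤ l b + l (a * b) + l (a⁻¹ * b) + 1 :=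
      max_le (by linarith) (max_le (by linarith) (by linarith))
    linarith
  have hpM' : L' p ≤ M := by rw [← hp]; exact (hL'.pow_le' a k).trans (by linarith)
  have hqM' : L' q ≤ M := by rw [← hq]; exact (hL'.pow_le' b k).trans (by linarith)
  have hpp' : IsPingPong L' p q C := by
    rw [← hp, ← hq] at w1 w2 w3 w4 t1 t2 t3 t4 ⊢
    exact hL'.isPingPong_pow (K := K) hLa hLb (by linarith) (by linarith)
      (by linarith) (by linarith) (by linarith) (by linarith) (by linarith)
  refine ⟨L', hL', fun g hg => abs_sub_le_of_isPingPong hL hL' hpp hpp' hpM hqM hpM' hqM'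
    fun t ht => ?_⟩
  refine (hW (g * t) (Finset.mem_union_right _ (Finset.mem_biUnion.2 ⟨g, hg,
    Finset.mem_image_of_mem _ ?_⟩))).trans (by linarith)
  simpa [T] using ht

/-! ### From a large ball to the whole group. -/

/-- Displacement along a chain of elements with little cancellation between neighbours. -/
lemma chain_aux (hL : IsTreeLength L l) {κ : ℝ} (gs : List G) :
    ∀ g : G, (∀ x ∈ g :: gs, 2 * κ < L x) →
      (g :: gs).IsChain (fun x y => gromovProduct L x⁻¹ y ≤ κ) →
      ((g :: gs).map L).sum - 2 * κ * gs.length ≤ L (g :: gs).prod ∧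
        ∀ f, gromovProduct L f g ≤ κ → gromovProduct L f (g :: gs).prod ≤ κ := by
  induction gs with
  | nil => intro g _ _; simp
  | cons g' gs ih =>
    intro g hl hc
    rw [List.isChain_cons_cons] at hc
    obtain ⟨h1, h2⟩ := ih g' (fun x hx => hl x (List.mem_cons_of_mem _ hx)) hc.2
    have h3 := h2 _ hc.1
    rw [List.prod_cons (a := g), List.map_cons, List.sum_cons, List.length_cons]
    refine ⟨?_, fun f hf => hL.gp_le_of_gp_lt hf ?_⟩
    · rw [mul_eq L hL.inv]; push_cast; linarith
    · rw [gp_mul L hL.inv]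
      have := hl g (by simp)
      linarith

lemma sum_le_of_isChain (hL : IsTreeLength L l) {κ : ℝ} (hκ : 0 ≤ κ) {gs : List G}
    (hl : ∀ x ∈ gs, 2 * κ < L x) (hc : gs.IsChain (fun x y => gromovProduct L x⁻¹ y ≤ κ)) :
    (gs.map L).sum - 2 * κ * gs.length ≤ L gs.prod := by
  cases gs with
  | nil => simp [hL.one]
  | cons g gs =>
    refine le_trans ?_ (hL.chain_aux gs g hl hc).1
    rw [List.length_cons]; push_cast; linarith

lemma prod_le_sum (hL : IsTreeLength L l) (gs : List G) : L gs.prod ≤ (gs.map L).sum := by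
  induction gs with
  | nil => simp [hL.one]
  | cons g gs ih =>
    rw [List.prod_cons, List.map_cons, List.sum_cons]
    exact (hL.mul_le _ _).trans (by linarith)

end IsTreeLength

/-- Every element is, up to a bounded error, a product along a geodesic of elements whose
displacement is a prescribed number `R`. -/
def HasChains {G : Type*} [Group G] (L : G → ℝ) (D : ℝ) : Prop :=
  ∀ R > 0, ∀ g, ∃ (gs : List G) (r : G), g = gs.prod * r ∧
    (∀ x ∈ gs, R - D ≤ L x ∧ L x ≤ R + D) ∧ L r ≤ R + D ∧
    gs.IsChain fun x y => gromovProduct L x⁻¹ y ≤ D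

lemma List.IsChain.imp_of_forall_mem {α : Type*} {R S : α → α → Prop} {p : α → Prop}
    (h : ∀ x y, p x → p y → R x y → S x y) {as : List α} (hp : ∀ x ∈ as, p x)
    (hR : as.IsChain R) : as.IsChain S := by
  induction as with
  | nil => exact .nil
  | cons a as ih =>
    cases as with
    | nil => exact .singleton a
    | cons b as =>
      rw [List.isChain_cons_cons] at hR ⊢
      exact ⟨h _ _ (hp _ (by simp)) (hp _ (by simp)) hR.1,
        ih (fun x hx => hp x (List.mem_cons_of_mem _ hx)) hR.2⟩

namespace IsTreeLength

variable {G : Type*} [Group G] {L l L' l' : G → ℝ}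

lemma abs_sub_sum_le (hL : IsTreeLength L l) {κ E : ℝ} (hκ : 0 ≤ κ) {gs : List G} {r : G}
    (hl : ∀ x ∈ gs, 2 * κ < L x) (hc : gs.IsChain fun x y => gromovProduct L x⁻¹ y ≤ κ)
    (hr : L r ≤ E) : |L (gs.prod * r) - (gs.map L).sum| ≤ 2 * κ * gs.length + E := by
  have h1 := hL.sum_le_of_isChain hκ hl hc
  have h2 := hL.prod_le_sum gs
  have h3 := hL.mul_le gs.prod r
  have h4 := hL.le_mul gs.prod r
  have h5 : 0 ≤ 2 * κ * gs.length := by positivity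
  rw [abs_le]
  constructor <;> linarith

/-- Displacements that agree up to a constant on a large ball are close everywhere. -/
lemma abs_sub_le_of_hasChains (hL : IsTreeLength L l) (hL' : IsTreeLength L' l') {C D R : ℝ}
    (hC : 0 ≤ C) (hD : 0 ≤ D) (hch : HasChains L D) (hR : 4 * C + 3 * D < R)
    (h : ∀ g, L g ≤ 2 * (R + D) → |L' g - L g| ≤ C) (g : G) :
    ∃ s m : ℝ, 0 ≤ m ∧ (R - D) * m ≤ s ∧ |L g - s| ≤ (4 * C + 2 * D) * m + (R + C + D) ∧
      |L' g - s| ≤ (4 * C + 2 * D) * m + (R + C + D) := by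
  obtain ⟨gs, r, rfl, hgs, hr, hc⟩ := hch R (by linarith) g
  have hsmall : ∀ x ∈ gs, |L' x - L x| ≤ C := fun x hx => h x (by linarith [hgs x hx])
  have hsum : |(gs.map L').sum - (gs.map L).sum| ≤ C * gs.length ∧
      (R - D) * gs.length ≤ (gs.map L).sum := by
    clear hc
    induction gs with
    | nil => simp
    | cons x gs ih =>
      obtain ⟨h1, h2⟩ := ih (fun y hy => hgs y (List.mem_cons_of_mem _ hy))
        (fun y hy => hsmall y (List.mem_cons_of_mem _ hy))
      have h3 := abs_le.1 (hsmall x (by simp))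
      have h4 := hgs x (by simp)
      rw [abs_le] at h1 ⊢
      simp only [List.map_cons, List.sum_cons, List.length_cons]
      push_cast
      exact ⟨⟨by linarith, by linarith⟩, by linarith⟩
  -- Both displacements are compared with the sum s of the displacements L of the m links.
  refine ⟨(gs.map L).sum, gs.length, by positivity, hsum.2, ?_, ?_⟩
  · refine (hL.abs_sub_sum_le hD (fun x hx => by linarith [hgs x hx]) hc hr).trans ?_
    have : 0 ≤ C * gs.length := by positivity
    linarith
  -- A Gromov product is half a signed sum of three displacements, each changed by at most C. The
  -- radius 2 (R + D) is there to cover products of two neighbouring links.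
  · have hc' : gs.IsChain fun x y => gromovProduct L' x⁻¹ y ≤ D + 3 / 2 * C := by
      refine hc.imp_of_forall_mem (p := fun x => x ∈ gs) (fun x y hx hy hxy => ?_) fun x hx => hx
      have h1 := abs_le.1 (hsmall x hx)
      have h2 := abs_le.1 (hsmall y hy)
      have h3 := abs_le.1 (h (x * y) ((hL.mul_le x y).trans (by linarith [hgs x hx, hgs y hy])))
      simp only [gromovProduct, inv_inv, hL.inv, hL'.inv] at hxy ⊢
      linarith
    have hr' := abs_le.1 (h r (by linarith))
    have h1 := hL'.abs_sub_sum_le (κ := D + 3 / 2 * C) (E := R + C + D) (by positivity)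
      (fun x hx => by linarith [hgs x hx, abs_le.1 (hsmall x hx)]) hc' (by linarith)
    have h2 := abs_le.1 h1
    have h3 := abs_le.1 hsum.1
    rw [abs_le]
    constructor <;> linarith

/-- For a cocompact, properly discontinuous action on a tree, translation lengths of another
action that are close on a suitable finite set are uniformly close. -/
theorem exists_forall_translation_le (hL : IsTreeLength L l) (hfin : ∀ R, {g | L g ≤ R}.Finite)
    {D : ℝ} (hD : 0 ≤ D) (hch : HasChains L D) {a b : G}
    (hab : ∀ i : ℕ, i ≠ 0 → ¬ Commute (a ^ i) b) (ha : 0 < l a) (hb : 0 < l b)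
    {ε : ℝ} (hε : 0 < ε) :
    ∃ W : Finset G, ∃ δ > 0, ∀ l' : G → ℝ, (∃ L', IsTreeLength L' l' ∧ L' a = l' a) →
      (∀ w ∈ W, |l' w - l w| ≤ δ) → ∀ u, l' u ≤ (1 + ε) * l u ∧ l u ≤ (1 + ε) * l' u := by
  obtain ⟨C, hC⟩ := hL.exists_abs_sub_le hfin hab ha hb
  set B := max C 0 with hB
  have hB0 : 0 ≤ B := le_max_right _ _
  set Q := 4 * B + 2 * D with hQ
  have hQ0 : 0 ≤ Q := by positivity
  -- Q bounds the error per link. The last summand makes (2 + ε) Q at most ε times the length R − D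
  -- of a link. R may depend on C because C precedes the choice of the finite set.
  set R := 4 * B + 3 * D + 1 + Q * (2 + ε) / ε with hR
  have hQR : 0 ≤ Q * (2 + ε) / ε := by positivity
  obtain ⟨W, δ, hδ, hW⟩ := hC (hfin (2 * (R + D))).toFinset
  refine ⟨W, δ, hδ, fun l' hT hl => ?_⟩
  obtain ⟨L', hL', hS⟩ := hW l' hT hl
  have key : ∀ g, L' g ≤ (1 + ε) * L g + (2 + ε) * (R + B + D) ∧
      L g ≤ (1 + ε) * L' g + (2 + ε) * (R + B + D) := fun g => by
    obtain ⟨s, m, hm, hs, h1, h2⟩ := hL.abs_sub_le_of_hasChains hL' hB0 hD hch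
      (R := R) (by linarith) (fun g hg => (hS g (by simpa using hg)).trans (le_max_left _ _)) g
    rw [← hQ, abs_le] at h1 h2
    have h3 : Q * (2 + ε) * m ≤ ε * s := by
      have h4 : Q * (2 + ε) / ε * m ≤ s := by
        refine le_trans ?_ hs
        gcongr
        linarith
      calc Q * (2 + ε) * m = ε * (Q * (2 + ε) / ε * m) := by field_simp
        _ ≤ ε * s := by gcongr
    have h4 := mul_le_mul_of_nonneg_left h1.1 (by linarith : 0 ≤ 1 + ε)
    have h5 := mul_le_mul_of_nonneg_left h2.1 (by linarith : 0 ≤ 1 + ε)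
    constructor <;> nlinarith
  intro u
  constructor
  · refine le_of_forall_nat_mul_le (C := (1 + ε) * L u + (2 + ε) * (R + B + D)) fun k => ?_
    have h1 := mul_le_mul_of_nonneg_left (hL.pow_le' u k) (by linarith : 0 ≤ 1 + ε)
    linarith [hL'.pow_ge u k, (key (u ^ k)).1]
  · refine le_of_forall_nat_mul_le (C := (1 + ε) * L' u + (2 + ε) * (R + B + D)) fun k => ?_
    have h1 := mul_le_mul_of_nonneg_left (hL'.pow_le' u k) (by linarith : 0 ≤ 1 + ε)
    linarith [hL.pow_ge u k, (key (u ^ k)).2]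

end IsTreeLength

/-! ### Free groups with weighted generators, acting on their Cayley trees. -/

lemma List.exists_longest_common_prefix {α : Type*} (x y : List α) :
    ∃ p x' y', x = p ++ x' ∧ y = p ++ y' ∧ (∀ a ∈ x'.head?, ∀ b ∈ y'.head?, a ≠ b) ∧
      ∀ q, q <+: x → q <+: y → q <+: p := by
  induction x generalizing y with
  | nil => exact ⟨[], [], y, by simp, by simp, by simp, fun q h _ => h⟩
  | cons a x ih =>
    cases y with
    | nil => exact ⟨[], a :: x, [], by simp, by simp, by simp, fun q _ h => h⟩
    | cons b y =>
      by_cases hab : a = b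
      · subst hab
        obtain ⟨p, x', y', rfl, rfl, h1, h2⟩ := ih y
        refine ⟨a :: p, x', y', rfl, rfl, h1, fun q hq hq' => ?_⟩
        cases q with
        | nil => exact List.nil_prefix
        | cons c q =>
          rw [List.cons_prefix_cons] at hq hq' ⊢
          exact ⟨hq.1, h2 q hq.2 hq'.2⟩
      · refine ⟨[], a :: x, b :: y, rfl, rfl, by simpa using hab, fun q hq hq' => ?_⟩
        cases q with
        | nil => exact List.nil_prefix
        | cons c q =>
          rw [List.cons_prefix_cons] at hq hq'
          exact absurd (hq.1.symm.trans hq'.1) hab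

namespace FreeGroup

variable {α : Type*} {w : α → ℝ}

/-- Length of a word in which the letters `a` and `a⁻¹` have length `w a`. -/
def wordLen (w : α → ℝ) (p : List (α × Bool)) : ℝ := (p.map fun a => w a.1).sum

@[simp] lemma wordLen_nil : wordLen w [] = 0 := rfl

@[simp] lemma wordLen_cons (a : α × Bool) (p : List (α × Bool)) :
    wordLen w (a :: p) = w a.1 + wordLen w p := rfl

@[simp] lemma wordLen_append (p q : List (α × Bool)) :
    wordLen w (p ++ q) = wordLen w p + wordLen w q := by simp [wordLen]

@[simp] lemma wordLen_invRev (p : List (α × Bool)) : wordLen w (invRev p) = wordLen w p := by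
  simp [wordLen, invRev, List.map_reverse, List.sum_reverse, Function.comp_def]

lemma wordLen_flatten_replicate (k : ℕ) (p : List (α × Bool)) :
    wordLen w (List.replicate k p).flatten = k * wordLen w p := by
  induction k with
  | zero => simp
  | succ k ih => rw [List.replicate_succ, List.flatten_cons, wordLen_append, ih]; push_cast; ring

lemma wordLen_nonneg (hw : ∀ a, 0 < w a) (p : List (α × Bool)) : 0 ≤ wordLen w p :=
  List.sum_nonneg fun x hx => by
    obtain ⟨a, -, rfl⟩ := List.mem_map.1 hx
    exact (hw _).le

lemma wordLen_le_of_sublist (hw : ∀ a, 0 < w a) {p q : List (α × Bool)} (h : p.Sublist q) :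
    wordLen w p ≤ wordLen w q :=
  (h.map _).sum_le_sum fun x hx => by
    obtain ⟨a, -, rfl⟩ := List.mem_map.1 hx
    exact (hw _).le

variable [DecidableEq α]

/-- Length of an element of the free group, for given lengths of the generators. -/
def weightedNorm (w : α → ℝ) (z : FreeGroup α) : ℝ := wordLen w z.toWord

/-- Length of the cyclically reduced conjugates of an element of the free group. -/
def cyclicNorm (w : α → ℝ) (z : FreeGroup α) : ℝ :=
  wordLen w (reduceCyclically z.toWord)

lemma isReduced_invRev {p : List (α × Bool)} (h : IsReduced p) : IsReduced (invRev p) := by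
  rw [isReduced_iff_reduce_eq, reduce_invRev, h.reduce_eq]

lemma weightedNorm_mk (w : α → ℝ) {p : List (α × Bool)} (h : IsReduced p) :
    weightedNorm w (mk p) = wordLen w p := by
  rw [weightedNorm, toWord_mk, h.reduce_eq]

lemma weightedNorm_mk_le (hw : ∀ a, 0 < w a) (p : List (α × Bool)) :
    weightedNorm w (mk p) ≤ wordLen w p := by
  rw [weightedNorm, toWord_mk]
  exact wordLen_le_of_sublist hw reduce.red.sublist

/-- After the longest common prefix is removed, what remains of x⁻¹ y is already reduced, so the
Gromov product is the length of that prefix. -/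
lemma exists_gromovProduct_eq (w : α → ℝ) (x y : FreeGroup α) :
    ∃ p, p <+: x.toWord ∧ p <+: y.toWord ∧ (∀ q, q <+: x.toWord → q <+: y.toWord → q <+: p) ∧
      gromovProduct (weightedNorm w) x y = wordLen w p := by
  obtain ⟨p, x', y', hx, hy, hne, hp⟩ := List.exists_longest_common_prefix x.toWord y.toWord
  refine ⟨p, ⟨x', hx.symm⟩, ⟨y', hy.symm⟩, hp, ?_⟩
  have hx' : IsReduced x' := (isReduced_toWord (x := x)).infix ⟨p, [], by simp [hx]⟩
  have hy' : IsReduced y' := (isReduced_toWord (x := y)).infix ⟨p, [], by simp [hy]⟩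
  have hr : IsReduced (invRev x' ++ y') := by
    rw [IsReduced, List.isChain_append]
    refine ⟨isReduced_invRev hx', hy', fun a ha b hb => ?_⟩
    simp only [invRev, List.getLast?_reverse, List.head?_map, Option.mem_def,
      Option.map_eq_some_iff] at ha
    obtain ⟨c, hc, rfl⟩ := ha
    have := hne c hc b hb
    intro h
    obtain ⟨c1, c2⟩ := c
    obtain ⟨b1, b2⟩ := b
    simp only at h
    subst h
    cases c2 <;> cases b2 <;> simp_all
  have hxy : x⁻¹ * y = mk (invRev x' ++ y') := by
    rw [← mk_toWord (x := x), ← mk_toWord (x := y), hx, hy, ← mul_mk, ← mul_mk, ← mul_mk, ← inv_mk]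
    group
  rw [gromovProduct, hxy, weightedNorm_mk w hr, weightedNorm, weightedNorm, hx, hy]
  simp only [wordLen_append, wordLen_invRev]
  ring

lemma weightedNorm_pow_succ (w : α → ℝ) (z : FreeGroup α) (k : ℕ) :
    weightedNorm w (z ^ (k + 1)) =
      (k + 1) * cyclicNorm w z + 2 * wordLen w (reduceCyclically.conjugator z.toWord) := by
  rw [weightedNorm, toWord_pow, reduceCyclically.reduce_flatten_replicate_succ isReduced_toWord]
  simp only [wordLen_append, wordLen_flatten_replicate, wordLen_invRev, cyclicNorm]
  push_cast; ring

lemma isTreeLength (hw : ∀ a, 0 < w a) : IsTreeLength (weightedNorm w) (cyclicNorm w) where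
  one := rfl
  inv g := by simp [weightedNorm]
  hyp x y z := by
    obtain ⟨p, hpx, hpy, -, hp⟩ := exists_gromovProduct_eq w x y
    obtain ⟨q, hqy, hqz, -, hq⟩ := exists_gromovProduct_eq w y z
    obtain ⟨r, -, -, hr, hr'⟩ := exists_gromovProduct_eq w x z
    rw [hp, hq, hr']
    -- Two prefixes of the word of y are nested, and the shorter one is common to x and z: this is
    -- 0-hyperbolicity.
    rcases List.prefix_or_prefix_of_prefix hpy hqy with h | h
    · exact (min_le_left _ _).trans
        (wordLen_le_of_sublist hw (hr p hpx (h.trans hqz)).sublist)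
    · exact (min_le_right _ _).trans
        (wordLen_le_of_sublist hw (hr q (h.trans hpx) hqz).sublist)
  pow_ge z k := by
    cases k with
    | zero => simp [weightedNorm]
    | succ k =>
      have := wordLen_nonneg hw (reduceCyclically.conjugator z.toWord)
      rw [weightedNorm_pow_succ]; push_cast; linarith
  pow_le z k := by
    have := weightedNorm_pow_succ w z 0
    rw [zero_add, pow_one] at this
    rw [weightedNorm_pow_succ, this]; push_cast; linarith

/-- Conjugating by the conjugator of the reduced word moves the base point onto the axis of z. -/
lemma exists_conj_weightedNorm_eq (w : α → ℝ) (z : FreeGroup α) :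
    ∃ c, weightedNorm w (c⁻¹ * z * c) = cyclicNorm w z := by
  refine ⟨mk (reduceCyclically.conjugator z.toWord), ?_⟩
  have h : z = mk (reduceCyclically.conjugator z.toWord) * mk (reduceCyclically z.toWord) *
      (mk (reduceCyclically.conjugator z.toWord))⁻¹ := by
    rw [inv_mk, mul_mk, mul_mk, reduceCyclically.conj_conjugator_reduceCyclically, mk_toWord]
  nth_rw 2 [h]
  rw [show ∀ c m : FreeGroup α, c⁻¹ * (c * m * c⁻¹) * c = m by intro c m; group,
    weightedNorm_mk w (reduceCyclically.isCyclicallyReduced isReduced_toWord).isReduced, cyclicNorm]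

lemma cyclicNorm_pos (hw : ∀ a, 0 < w a) {z : FreeGroup α} (hz : z ≠ 1) : 0 < cyclicNorm w z := by
  rw [cyclicNorm]
  have h := reduceCyclically.conj_conjugator_reduceCyclically z.toWord
  cases hr : reduceCyclically z.toWord with
  | nil =>
    refine absurd ?_ hz
    rw [hr] at h
    rw [← mk_toWord (x := z), ← h, List.append_nil, ← mul_mk, ← inv_mk, mul_inv_cancel]
  | cons a p =>
    have := wordLen_nonneg hw p
    have := hw a.1
    rw [wordLen_cons]; linarith

lemma finite_weightedNorm_le [Finite α] (hw : ∀ a, 0 < w a) (R : ℝ) :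
    {z | weightedNorm w z ≤ R}.Finite := by
  obtain ⟨m, hm, hmw⟩ : ∃ m > 0, ∀ a, m ≤ w a := by
    cases isEmpty_or_nonempty α with
    | inl h => exact ⟨1, one_pos, fun a => isEmptyElim a⟩
    | inr h =>
      obtain ⟨a, ha⟩ := Finite.exists_min w
      exact ⟨w a, hw a, ha⟩
  have hlen : ∀ p : List (α × Bool), m * p.length ≤ wordLen w p := fun p => by
    induction p with
    | nil => simp
    | cons a p ih =>
      rw [wordLen_cons, List.length_cons]; push_cast
      linarith [hmw a.1]
  obtain ⟨k, hk⟩ := exists_nat_gt (R / m)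
  rw [div_lt_iff₀ hm] at hk
  refine Set.Finite.of_finite_image (f := toWord) ?_ toWord_injective.injOn
  refine (List.finite_length_le (α × Bool) k).subset ?_
  rintro _ ⟨z, hz, rfl⟩
  have h1 : m * (z.toWord.length : ℝ) < m * k := by
    rw [mul_comm m (k : ℝ)]; exact ((hlen z.toWord).trans hz).trans_lt hk
  exact_mod_cast (lt_of_mul_lt_mul_left h1 hm.le).le

lemma not_commute_of_pow {x y : α} (hxy : x ≠ y) {i : ℕ} (hi : i ≠ 0) :
    ¬ Commute (of x ^ i) (of y) := by
  intro h
  have h1 := congrArg toWord h.eq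
  have hpos : ∀ p : List (α × Bool), (∀ a ∈ p, a.2 = true) → reduce p = p := fun p hp =>
    IsReduced.reduce_eq <| List.IsChain.imp_of_forall_mem (R := fun _ _ => True)
      (S := fun a b : α × Bool => a.1 = b.1 → a.2 = b.2) (p := fun a => a.2 = true)
      (fun a b ha hb _ _ => ha.trans hb.symm) hp
      (List.isChain_iff_forall_rel_of_append_cons_cons.2 fun _ _ _ _ _ => trivial)
  obtain ⟨j, rfl⟩ := Nat.exists_eq_succ_of_ne_zero hi
  rw [toWord_mul, toWord_mul, toWord_of_pow, toWord_of, hpos _ (by simp), hpos _ (by simp)]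
    at h1
  simp [List.replicate_succ] at h1
  exact hxy h1.1

end FreeGroup

/-! ### Marked graphs: the fundamental group inside the free group on the edges. -/

lemma IsTreeLength.comp {G H : Type*} [Group G] [Group H] {L l : G → ℝ} (hL : IsTreeLength L l)
    (φ : H →* G) : IsTreeLength (fun h => L (φ h)) fun h => l (φ h) where
  one := by simpa using hL.one
  inv g := by simpa using hL.inv (φ g)
  hyp g h k := by simpa [gromovProduct] using hL.hyp (φ g) (φ h) (φ k)
  pow_ge g k := by simpa using hL.pow_ge (φ g) k
  pow_le g k := by simpa using hL.pow_le (φ g) k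

section

open FreeGroup

namespace MetricGraph

variable {A : MetricGraph}

lemma isPath_append {p q : List A.Dart} {u w : A.V} :
    A.IsPath u (p ++ q) w ↔ ∃ v, A.IsPath u p v ∧ A.IsPath v q w := by
  constructor
  · intro h
    induction p generalizing u with
    | nil => exact ⟨u, rfl, h⟩
    | cons a p ih =>
      obtain ⟨v, h1, h2⟩ := ih h.2
      exact ⟨v, ⟨h.1, h1⟩, h2⟩
  · rintro ⟨v, h1, h2⟩
    exact h1.append h2

lemma IsPath.target_unique {p : List A.Dart} {u v v' : A.V} (h : A.IsPath u p v)
    (h' : A.IsPath u p v') : v = v' := by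
  induction p generalizing u with
  | nil => exact Eq.trans (Eq.symm h) h'
  | cons a p ih => exact ih h.2 h'.2

lemma IsPath.of_red {p q : List A.Dart} {u v : A.V} (h : A.IsPath u p v) (hr : Red p q) :
    A.IsPath u q v := by
  induction hr with
  | refl => exact h
  | tail _ hs ih =>
    obtain @⟨L₁, L₂, x, b⟩ := hs
    obtain ⟨y, h1, h2, h3, h4⟩ := isPath_append.1 ih
    have h5 : A.dartTgt (x, !b) = A.dartSrc (x, b) := by cases b <;> rfl
    rw [h5, h2] at h4
    exact h1.append h4

lemma exists_isPath (A : MetricGraph) (u v : A.V) : ∃ p, A.IsPath u p v := by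
  induction A.connected u v with
  | refl => exact ⟨[], rfl⟩
  | tail _ h ih =>
    obtain ⟨p, hp⟩ := ih
    obtain ⟨e, ⟨h1, h2⟩ | ⟨h1, h2⟩⟩ := h
    · exact ⟨p ++ [(e, true)], hp.append ⟨h1, h2⟩⟩
    · exact ⟨p ++ [(e, false)], hp.append ⟨h2, h1⟩⟩

/-- A path of length at least `R` has an initial segment of length about `R`. -/
lemma exists_prefix {M R : ℝ} (hM : ∀ e, A.len e ≤ M) (p : List A.Dart) (hR : 0 < R)
    (hp : R ≤ A.pathLen p) :
    ∃ q r, p = q ++ r ∧ q ≠ [] ∧ R ≤ A.pathLen q ∧ A.pathLen q ≤ R + M := by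
  induction p using List.reverseRecOn with
  | nil => simp [pathLen] at hp; linarith
  | append_singleton p a ih =>
    rcases le_or_gt R (A.pathLen p) with h | h
    · obtain ⟨q, r, rfl, h1, h2, h3⟩ := ih h
      exact ⟨q, r ++ [a], by simp, h1, h2, h3⟩
    · refine ⟨p ++ [a], [], by simp, by simp, hp, ?_⟩
      have := hM a.1
      simp only [pathLen, List.map_append, List.sum_append, List.map_cons, List.map_nil,
        List.sum_cons, List.sum_nil] at h ⊢
      linarith

end MetricGraph

namespace MarkedGraph

variable {n : ℕ}

/-- The marking as a homomorphism to the free group on the edges. -/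
def toFreeGroup (A : MarkedGraph n) : FreeGroup (Fin n) →* FreeGroup A.E :=
  (A.pi1 A.base).subtype.comp A.marking.toMonoidHom

lemma toFreeGroup_injective (A : MarkedGraph n) : Function.Injective A.toFreeGroup :=
  Subtype.val_injective.comp A.marking.injective

lemma exists_toFreeGroup_eq (A : MarkedGraph n) {p : List A.Dart} (hp : A.IsPath A.base p A.base) :
    ∃ g, A.toFreeGroup g = FreeGroup.mk p :=
  ⟨A.marking.symm ⟨FreeGroup.mk p, p, hp, rfl⟩, congrArg Subtype.val (A.marking.apply_symm_apply _)⟩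

section

variable (A : MarkedGraph n) [DecidableEq A.E]

/-- Displacement of the base vertex of the universal cover. -/
def baseLength (g : FreeGroup (Fin n)) : ℝ := weightedNorm A.len (A.toFreeGroup g)

/-- The cyclically reduced core of the word of g is itself a closed edge path, which gives one
bound. Any other representative is conjugate to it in the free group on the edges, and so is no
shorter. -/
lemma translationLength_eq (g : FreeGroup (Fin n)) :
    A.translationLength g = cyclicNorm A.len (A.toFreeGroup g) := by
  have hT := FreeGroup.isTreeLength A.len_pos
  apply le_antisymm
  · obtain ⟨p, hp, hw⟩ := (A.marking g).2
    have hp' : A.IsPath A.base (A.toFreeGroup g).toWord A.base := by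
      have h : A.toFreeGroup g = FreeGroup.mk p := hw.symm
      rw [h, toWord_mk]
      exact hp.of_red reduce.red
    have hc := reduceCyclically.conj_conjugator_reduceCyclically (A.toFreeGroup g).toWord
    rw [← hc, List.append_assoc] at hp'
    obtain ⟨v, h1, h2⟩ := MetricGraph.isPath_append.1 hp'
    obtain ⟨v', h2, h3⟩ := MetricGraph.isPath_append.1 h2
    have h4 := h3.rev
    rw [invRev_invRev] at h4
    obtain rfl := h1.target_unique h4
    refine csInf_le ⟨0, ?_⟩ ⟨v, _, ⟨h2, _, h1, ?_⟩, rfl⟩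
    · rintro _ ⟨v, p, -, rfl⟩
      exact A.pathLen_nonneg p
    · change FreeGroup.mk _ * FreeGroup.mk _ * (FreeGroup.mk _)⁻¹ = A.toFreeGroup g
      rw [inv_mk, mul_mk, mul_mk, hc, mk_toWord]
  · refine le_csInf ?_ ?_
    · obtain ⟨v, p, hp⟩ := A.exists_represents g
      exact ⟨_, v, p, hp, rfl⟩
    · rintro _ ⟨v, p, ⟨-, q, -, hq⟩, rfl⟩
      change FreeGroup.mk q * FreeGroup.mk p * (FreeGroup.mk q)⁻¹ = A.toFreeGroup g at hq
      rw [← hq, hT.translation_conj]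
      exact (hT.le_length _).trans (weightedNorm_mk_le A.len_pos p)

lemma isTreeLength : IsTreeLength A.baseLength A.translationLength := by
  have h := (FreeGroup.isTreeLength A.len_pos).comp A.toFreeGroup
  rwa [show A.translationLength = fun g => cyclicNorm A.len (A.toFreeGroup g) from
    funext A.translationLength_eq]

lemma finite_baseLength_le (R : ℝ) : {g | A.baseLength g ≤ R}.Finite :=
  have := A.finite_E
  (finite_weightedNorm_le A.len_pos R).preimage A.toFreeGroup_injective.injOn

end

lemma translationLength_pos (A : MarkedGraph n) {g : FreeGroup (Fin n)} (hg : g ≠ 1) :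
    0 < A.translationLength g := by
  classical
  rw [translationLength_eq]
  exact cyclicNorm_pos A.len_pos ((map_ne_one_iff _ A.toFreeGroup_injective).2 hg)

lemma exists_isTreeLength (A : MarkedGraph n) (a : FreeGroup (Fin n)) :
    ∃ L, IsTreeLength L A.translationLength ∧ L a = A.translationLength a := by
  classical
  obtain ⟨c, hc⟩ := exists_conj_weightedNorm_eq A.len (A.toFreeGroup a)
  -- The conjugation takes place in the free group on the edges, before restriction along the
  -- marking, since c need not be a closed path at the base vertex.
  have h := ((FreeGroup.isTreeLength A.len_pos).conj c).comp A.toFreeGroup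
  rw [← show A.translationLength = fun g => cyclicNorm A.len (A.toFreeGroup g) from
    funext A.translationLength_eq] at h
  exact ⟨_, h, hc.trans (A.translationLength_eq a).symm⟩

lemma exists_paths_from_base (A : MarkedGraph n) :
    ∃ c : A.V → List A.Dart, c A.base = [] ∧ (∀ v, A.IsPath A.base (c v) v) ∧
      ∃ D, 0 ≤ D ∧ ∀ v, A.pathLen (c v) ≤ D := by
  have h : ∀ v, ∃ p, A.IsPath A.base p v ∧ (v = A.base → p = []) := fun v => by
    by_cases hv : v = A.base
    · exact ⟨[], hv.symm, fun _ => rfl⟩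
    · obtain ⟨p, hp⟩ := A.exists_isPath A.base v
      exact ⟨p, hp, fun h => absurd h hv⟩
  choose c hc hc' using h
  have := A.finite_V
  obtain ⟨D, hD⟩ := (Set.finite_range fun v => A.pathLen (c v)).bddAbove
  exact ⟨c, hc' _ rfl, hc, max D 0, le_max_right _ _,
    fun v => (hD ⟨v, rfl⟩).trans (le_max_left _ _)⟩

/-- The reduced loop of g is cut into segments of length about R, and each segment is closed up
through the base vertex by connecting paths of length at most D. Consecutive segments do not cancel,
so the cancellation comes only from the connecting paths. -/
lemma exists_hasChains (A : MarkedGraph n) [DecidableEq A.E] :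
    ∃ D, 0 ≤ D ∧ HasChains A.baseLength D := by
  obtain ⟨c, hcb, hc, D, hD, hcD⟩ := A.exists_paths_from_base
  have := A.finite_E
  obtain ⟨M, hM⟩ := (Set.finite_range A.len).bddAbove
  replace hM : ∀ e, A.len e ≤ max M 0 := fun e => (hM ⟨e, rfl⟩).trans (le_max_left _ _)
  have hM0 : 0 ≤ max M 0 := le_max_right _ _
  generalize max M 0 = M at hM hM0
  have hT := FreeGroup.isTreeLength A.len_pos
  have hN : ∀ v, weightedNorm A.len (FreeGroup.mk (c v)) ≤ D := fun v =>
    (weightedNorm_mk_le A.len_pos (c v)).trans (hcD v)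
  have hbound : ∀ y z p g, IsReduced p →
      A.toFreeGroup g = FreeGroup.mk (c y) * FreeGroup.mk p * (FreeGroup.mk (c z))⁻¹ →
      A.pathLen p - 2 * D ≤ A.baseLength g ∧ A.baseLength g ≤ A.pathLen p + 2 * D := by
    intro y z p g hp hg
    have e : weightedNorm A.len (FreeGroup.mk p) = A.pathLen p := weightedNorm_mk A.len hp
    rw [baseLength, hg]
    have h1 := hT.mul_le (FreeGroup.mk (c y) * FreeGroup.mk p) (FreeGroup.mk (c z))⁻¹
    have h2 := hT.mul_le (FreeGroup.mk (c y)) (FreeGroup.mk p)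
    have h3 := hT.le_mul (FreeGroup.mk (c y) * FreeGroup.mk p) (FreeGroup.mk (c z))⁻¹
    have h4 := hT.mul_le (FreeGroup.mk (c y))⁻¹ (FreeGroup.mk (c y) * FreeGroup.mk p)
    rw [inv_mul_cancel_left] at h4
    simp only [hT.inv] at h1 h3 h4
    constructor <;> linarith [hN y, hN z]
  have hex : ∀ y z p, A.IsPath y p z →
      ∃ g, A.toFreeGroup g = FreeGroup.mk (c y) * FreeGroup.mk p * (FreeGroup.mk (c z))⁻¹ := by
    intro y z p hp
    obtain ⟨g, hg⟩ := A.exists_toFreeGroup_eq (((hc y).append hp).append (hc z).rev)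
    exact ⟨g, by rw [hg, ← mul_mk, ← mul_mk, ← inv_mk]⟩
  -- Closing up a segment costs 2 D, and a cut overshoots R by at most one edge, of length at most
  -- M. Three displacements with error 2 D give Gromov products at most 3 D.
  refine ⟨3 * D + M, by positivity, fun R hR => ?_⟩
  have key : ∀ k : ℕ, ∀ p : List A.Dart, p.length ≤ k → ∀ y z, A.IsPath y p z → IsReduced p →
      ∃ (gs : List (FreeGroup (Fin n))) (r : FreeGroup (Fin n)),
        A.toFreeGroup (gs.prod * r) = FreeGroup.mk (c y) * FreeGroup.mk p * (FreeGroup.mk (c z))⁻¹ ∧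
        (∀ x ∈ gs, R - (3 * D + M) ≤ A.baseLength x ∧ A.baseLength x ≤ R + (3 * D + M)) ∧
        A.baseLength r ≤ R + (3 * D + M) ∧
        -- The segment p₀ preceding p is carried along so that the induction controls the junction
        -- between neighbouring links.
        ∀ x p₀ g₀, A.IsPath x p₀ y → IsReduced (p₀ ++ p) →
          A.toFreeGroup g₀ = FreeGroup.mk (c x) * FreeGroup.mk p₀ * (FreeGroup.mk (c y))⁻¹ →
          (g₀ :: gs).IsChain fun g h => gromovProduct A.baseLength g⁻¹ h ≤ 3 * D + M := by
    intro k
    induction k with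
    | zero =>
      intro p hk y z hp hr
      obtain ⟨g, hg⟩ := hex y z p hp
      obtain rfl : p = [] := List.length_eq_zero_iff.1 (Nat.le_zero.1 hk)
      refine ⟨[], g, by simpa using hg, by simp, ?_, fun _ _ _ _ _ _ => .singleton _⟩
      have := (hbound y z [] g hr hg).2
      have h0 : A.pathLen [] = 0 := rfl
      linarith
    | succ k ih =>
      intro p hk y z hp hr
      rcases lt_or_ge (A.pathLen p) R with hlt | hge
      · obtain ⟨g, hg⟩ := hex y z p hp
        refine ⟨[], g, by simpa using hg, by simp, ?_, fun _ _ _ _ _ _ => .singleton _⟩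
        linarith [(hbound y z p g hr hg).2]
      · obtain ⟨p₁, p₂, rfl, hne, h1, h2⟩ := MetricGraph.exists_prefix hM p hR hge
        obtain ⟨v, hp₁, hp₂⟩ := MetricGraph.isPath_append.1 hp
        have hr₁ : IsReduced p₁ := hr.infix ⟨[], p₂, by simp⟩
        have hr₂ : IsReduced p₂ := hr.infix ⟨p₁, [], by simp⟩
        have hlen : p₂.length ≤ k := by
          have := List.length_pos_iff.2 hne
          rw [List.length_append] at hk
          omega
        obtain ⟨gs, r, e1, e2, e3, e4⟩ := ih p₂ hlen v z hp₂ hr₂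
        obtain ⟨g₁, hg₁⟩ := hex y v p₁ hp₁
        have hb₁ := hbound y v p₁ g₁ hr₁ hg₁
        refine ⟨g₁ :: gs, r, ?_, ?_, e3, ?_⟩
        · rw [List.prod_cons, mul_assoc, _root_.map_mul, e1, hg₁, ← mul_mk]
          group
        · intro x hx
          rcases List.mem_cons.1 hx with rfl | hx
          · constructor <;> linarith
          · exact e2 x hx
        · intro x p₀ g₀ hp₀ hr₀ hg₀
          rw [List.isChain_cons_cons]
          refine ⟨?_, e4 y p₁ g₁ hp₁ hr hg₁⟩
          have hr₀₁ : IsReduced (p₀ ++ p₁) := hr₀.infix ⟨[], p₂, by simp⟩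
          have hb₀ := hbound x y p₀ g₀ (hr₀.infix ⟨[], p₁ ++ p₂, by simp⟩) hg₀
          have hb := hbound x v (p₀ ++ p₁) (g₀ * g₁) hr₀₁ (by
            rw [_root_.map_mul, hg₀, hg₁, ← mul_mk]; group)
          have hadd : A.pathLen (p₀ ++ p₁) = A.pathLen p₀ + A.pathLen p₁ := by
            simp [MetricGraph.pathLen]
          simp only [gromovProduct, inv_inv, A.isTreeLength.inv]
          linarith
  intro g
  obtain ⟨p, hp, hg⟩ := (A.marking g).2
  have hg' : A.toFreeGroup g = FreeGroup.mk p := hg.symm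
  obtain ⟨gs, r, e1, e2, e3, e4⟩ := key _ (reduce p) le_rfl A.base A.base (hp.of_red reduce.red)
    (isReduced_iff_reduce_eq.2 reduce.idem)
  refine ⟨gs, r, A.toFreeGroup_injective ?_, e2, e3, ?_⟩
  · rw [e1, hg', hcb, reduce.self, ← one_eq_mk]
    simp
  · have := e4 A.base [] 1 rfl (by simpa using isReduced_iff_reduce_eq.2 (reduce.idem (L := p)))
      (by simp [hcb, ← one_eq_mk])
    exact this.tail

end MarkedGraph

end

/-! ### Comparison of the two topologies. -/

open Filter Topology in
lemma Finset.eventually_forall_mem_of_isOpen {ι : Type*} {f : ι → ℝ} {I : Finset ι}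
    {u : ι → Set ℝ} (hu : ∀ i ∈ I, IsOpen (u i) ∧ f i ∈ u i) :
    ∀ᶠ ε in 𝓝[>] (0 : ℝ), ∀ i ∈ I, ∀ x, |x - f i| ≤ (Real.exp ε - 1) * f i → x ∈ u i := by
  rw [Finset.eventually_all]
  intro i hi
  obtain ⟨δ, hδ, hball⟩ := Metric.isOpen_iff.1 (hu i hi).1 _ (hu i hi).2
  have ht : Tendsto (fun ε => (Real.exp ε - 1) * f i) (𝓝[>] 0) (𝓝 0) := by
    have : Continuous fun ε => (Real.exp ε - 1) * f i := by fun_prop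
    simpa using (this.tendsto 0).mono_left nhdsWithin_le_nhds
  filter_upwards [ht.eventually (gt_mem_nhds hδ)] with ε hε x hx
  exact hball (hx.trans_lt hε)

namespace MarkedGraph

variable {n : ℕ}

/-- Marked graphs whose length functions are close on a suitable finite set have uniformly close
length functions. -/
lemma exists_forall_translationLength_le (hn : 2 ≤ n) (A : MarkedGraph n) {ε : ℝ} (hε : 0 < ε) :
    ∃ W : Finset (FreeGroup (Fin n)), ∃ δ > 0, ∀ (B : MarkedGraph n) (c : ℝ), 0 < c →
      (∀ w ∈ W, |c * B.translationLength w - A.translationLength w| ≤ δ) →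
      ∀ u, c * B.translationLength u ≤ (1 + ε) * A.translationLength u ∧
        A.translationLength u ≤ (1 + ε) * (c * B.translationLength u) := by
  classical
  obtain ⟨D, hD, hch⟩ := A.exists_hasChains
  obtain ⟨W, δ, hδ, hW⟩ := A.isTreeLength.exists_forall_translation_le A.finite_baseLength_le hD hch
    (a := FreeGroup.of ⟨0, by omega⟩) (b := FreeGroup.of ⟨1, by omega⟩)
    (fun i hi => FreeGroup.not_commute_of_pow (by simp) hi)
    (A.translationLength_pos (FreeGroup.of_ne_one _))
    (A.translationLength_pos (FreeGroup.of_ne_one _)) hε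
  refine ⟨W, δ, hδ, fun B c hc hB => hW _ ?_ hB⟩
  obtain ⟨L, hL, hLa⟩ := B.exists_isTreeLength (FreeGroup.of ⟨0, by omega⟩)
  exact ⟨_, hL.const_mul hc, congrArg (c * ·) hLa⟩

/-- The scale c occurs inversely in the two factors and cancels in their product. -/
lemma lambda_le {A B : MarkedGraph n} {ε c : ℝ} (hε : 0 ≤ ε) (hc : 0 < c)
    (h : ∀ u, c * B.translationLength u ≤ (1 + ε) * A.translationLength u ∧
      A.translationLength u ≤ (1 + ε) * (c * B.translationLength u)) :
    lambda A B ≤ ENNReal.ofReal ((1 + ε) * (1 + ε)) := by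
  have h1 : lambdaR A B ≤ ENNReal.ofReal ((1 + ε) / c) := by
    refine iSup₂_le fun u hu => ENNReal.ofReal_le_ofReal ?_
    rw [div_le_div_iff₀ (A.translationLength_pos hu) hc, mul_comm]
    exact (h u).1
  have h2 : lambdaL A B ≤ ENNReal.ofReal ((1 + ε) * c) := by
    refine iSup₂_le fun u hu => ENNReal.ofReal_le_ofReal ?_
    rw [div_le_iff₀ (B.translationLength_pos hu), mul_assoc]
    exact (h u).2
  refine (mul_le_mul' h1 h2).trans_eq ?_
  rw [← ENNReal.ofReal_mul (by positivity)]
  congr 1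
  field_simp

lemma translationLength_one (A : MarkedGraph n) : A.translationLength 1 = 0 := by
  obtain ⟨L, hL, h⟩ := A.exists_isTreeLength 1
  rw [← h, hL.one]

lemma exists_abs_sub_le_of_lambda_lt (hn : 0 < n) {A B : MarkedGraph n} {t : ℝ}
    (h : lambda A B < ENNReal.ofReal t) :
    ∃ c : ℝ, 0 < c ∧ ∀ u, |c * B.translationLength u - A.translationLength u| ≤
      (t - 1) * A.translationLength u := by
  have hpos : ∀ A B : MarkedGraph n, lambdaR A B ≠ 0 := fun A B hAB => by
    have hu : FreeGroup.of (⟨0, hn⟩ : Fin n) ≠ 1 := FreeGroup.of_ne_one _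
    have h1 := le_iSup₂ (f := fun (w : FreeGroup (Fin n)) (_ : w ≠ 1) =>
      ENNReal.ofReal (B.translationLength w / A.translationLength w)) _ hu
    change _ ≤ lambdaR A B at h1
    rw [hAB, nonpos_iff_eq_zero, ENNReal.ofReal_eq_zero] at h1
    exact absurd (div_pos (B.translationLength_pos hu) (A.translationLength_pos hu)) (not_lt.2 h1)
  have hR := hpos A B
  have hL : lambdaL A B ≠ 0 := hpos B A
  -- Since neither factor vanishes, finiteness of the product makes both factors finite.
  have htop : lambdaR A B * lambdaL A B ≠ ⊤ := (h.trans ENNReal.ofReal_lt_top).ne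
  have hR' : lambdaR A B ≠ ⊤ := fun e => htop (by rw [e, ENNReal.top_mul hL])
  have hL' : lambdaL A B ≠ ⊤ := fun e => htop (by rw [e, ENNReal.mul_top hR])
  have hlt : (lambdaR A B).toReal * (lambdaL A B).toReal < t := by
    rw [← ENNReal.toReal_mul]
    exact (ENNReal.lt_ofReal_iff_toReal_lt htop).1 h
  have hc : 0 < (lambdaL A B).toReal := ENNReal.toReal_pos hL hL'
  refine ⟨(lambdaL A B).toReal, hc, fun u => ?_⟩
  by_cases hu : u = 1
  · simp [hu, translationLength_one]
  have hA := A.translationLength_pos hu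
  have hB := B.translationLength_pos hu
  have h1 : B.translationLength u ≤ (lambdaR A B).toReal * A.translationLength u := by
    rw [← div_le_iff₀ hA, ← ENNReal.ofReal_le_iff_le_toReal hR']
    exact le_iSup₂ (f := fun (w : FreeGroup (Fin n)) (_ : w ≠ 1) =>
      ENNReal.ofReal (B.translationLength w / A.translationLength w)) u hu
  have h2 : A.translationLength u ≤ (lambdaL A B).toReal * B.translationLength u := by
    rw [← div_le_iff₀ hB, ← ENNReal.ofReal_le_iff_le_toReal hL']
    exact le_iSup₂ (f := fun (w : FreeGroup (Fin n)) (_ : w ≠ 1) =>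
      ENNReal.ofReal (A.translationLength w / B.translationLength w)) u hu
  have h3 := mul_le_mul_of_nonneg_left h1 hc.le
  have h4 := mul_le_mul_of_nonneg_right hlt.le hA.le
  rw [abs_le]
  constructor <;> linarith

end MarkedGraph

/-- The saturation of an open set is a union of its preimages under rescalings, which are
continuous. -/
lemma ProjectiveFunctions.isOpenMap_mk (n : ℕ) :
    IsOpenMap (Quotient.mk (homothetySetoid n)) := by
  intro O hO
  refine isQuotientMap_quotient_mk'.isOpen_preimage.1 ?_
  change IsOpen (Quotient.mk (homothetySetoid n) ⁻¹' _)
  have h : Quotient.mk (homothetySetoid n) ⁻¹' (Quotient.mk (homothetySetoid n) '' O) =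
      ⋃ c ∈ Set.Ioi (0 : ℝ), (fun f w => c * f w) ⁻¹' O := by
    ext f
    simp only [Set.mem_preimage, Set.mem_image, Set.mem_iUnion, Set.mem_Ioi, exists_prop]
    constructor
    · rintro ⟨g, hg, hgf⟩
      obtain ⟨c, hc, h⟩ := Quotient.exact hgf.symm
      refine ⟨c, hc, ?_⟩
      rwa [← show g = fun w => c * f w from funext h]
    · rintro ⟨c, hc, h⟩
      exact ⟨_, h, Eq.symm (Quotient.sound (s := homothetySetoid n) ⟨c, hc, fun w => rfl⟩)⟩
  rw [h]
  refine isOpen_biUnion fun c _ => hO.preimage ?_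
  fun_prop

namespace CV

lemma d_mk_lt_iff {n : ℕ} (A B : MarkedGraph n) (ε : ℝ) :
    d (Quotient.mk _ A) (Quotient.mk _ B) < (ε : EReal) ↔
      MarkedGraph.lambda A B < ENNReal.ofReal (Real.exp ε) := by
  rw [← ENNReal.log_lt_log_iff, ENNReal.log_ofReal_of_pos (Real.exp_pos ε), Real.log_exp]
  rfl

end CV

open Filter Topology in
/-- On Culler-Vogtmann space of rank `n`, the topology induced by the symmetric metric is the
topology induced from projectivised length functions. -/
theorem mainTheorem4 (n : ℕ) (hn : 2 ≤ n) : CV.metricTopology n = CV.lengthTopology n := by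
  -- The first goal takes a set open for length functions and shows it open for d; the second is the
  -- converse, which rests on the tree estimates.
  refine le_antisymm (fun U hU => ?_) (fun U hU => ?_)
  · rintro ⟨A⟩ hA
    obtain ⟨V, hV, rfl⟩ := isOpen_induced_iff.1 hU
    rw [← isQuotientMap_quotient_mk'.isOpen_preimage, isOpen_pi_iff] at hV
    obtain ⟨I, u, hu, hIu⟩ := hV A.translationLength hA
    obtain ⟨ε, hε, hε0⟩ := ((Finset.eventually_forall_mem_of_isOpen hu).and
      eventually_mem_nhdsWithin).exists
    refine ⟨ε, hε0, ?_⟩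
    rintro ⟨B⟩ hB
    obtain ⟨c, hc, h⟩ := MarkedGraph.exists_abs_sub_le_of_lambda_lt (by omega)
      ((CV.d_mk_lt_iff A B ε).1 hB)
    have hmem := hIu (a := fun w => c * B.translationLength w) fun w hw => hε w hw _ (h w)
    have he : (Quotient.mk _ B.translationLength : ProjectiveFunctions n) =
      Quotient.mk _ fun w => c * B.translationLength w := Quotient.sound ⟨c, hc, fun w => rfl⟩
    change (Quotient.mk _ B.translationLength : ProjectiveFunctions n) ∈ V
    rw [he]
    exact hmem
  · let _ := CV.lengthTopology n
    change IsOpen U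
    rw [isOpen_iff_mem_nhds]
    intro x hA
    rw [nhds_induced]
    obtain ⟨A, rfl⟩ := Quotient.exists_rep x
    obtain ⟨ε, hε, hball⟩ := hU _ hA
    obtain ⟨η, hη, hηε⟩ : ∃ η : ℝ, 0 < η ∧ (1 + η) * (1 + η) < Real.exp ε := by
      refine ⟨Real.exp (ε / 3) - 1, by simp [hε], ?_⟩
      rw [add_sub_cancel, ← Real.exp_add]
      exact Real.exp_lt_exp.2 (by linarith)
    obtain ⟨W, δ, hδ, hW⟩ := A.exists_forall_translationLength_le hn hη
    let O : Set (FreeGroup (Fin n) → ℝ) :=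
      (W : Set _).pi fun w => Metric.ball (A.translationLength w) δ
    have hO : IsOpen O := isOpen_set_pi W.finite_toSet fun w _ => Metric.isOpen_ball
    refine ⟨Quotient.mk _ '' O, (ProjectiveFunctions.isOpenMap_mk n O hO).mem_nhds
      ⟨_, fun w _ => Metric.mem_ball_self hδ, rfl⟩, ?_⟩
    rintro ⟨B⟩ ⟨f, hf, hfB⟩
    obtain ⟨c, hc, h⟩ := Quotient.exact hfB.symm
    refine hball _ ((CV.d_mk_lt_iff A B ε).2 ((MarkedGraph.lambda_le hη.le hc
      (hW B c hc fun w hw => ?_)).trans_lt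
      ((ENNReal.ofReal_lt_ofReal_iff (Real.exp_pos ε)).2 hηε)))
    rw [← h w]
    exact (Metric.mem_ball.1 (hf w hw)).le
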